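/- For $\alpha>0$, $R>0$ and Schwartz functions $f_1,f_2,f_3:\mathbb{R}\to\mathbb{C}$ let \[ \mathfrak{B}^{\alpha}_{R}(f_1,f_2,f_3)(x)=\int_{\mathbb{R}^{3}}\Big(1-\frac{\xi_1^2+\xi_2^2+\xi_3^2}{R^{2}}\Big)^{\alpha}_{+}\,\hat f_1(\xi_1)\hat f_2(\xi_2)\hat f_3(\xi_3)\,e^{2\pi i x(\xi_1+\xi_2+\xi_3)}\,d\xi_1d\xi_2d\xi_3 , \] where $r_+=\max\{r,0\}$ and $\hat f(\xi)=\int_{\mathbb{R}} f(x)e^{-2\pi i x\xi}\,dx$, and let $\mathfrak{B}^{\alpha}_{*}(f_1,f_2,f_3)(x)=\sup_{R>0}|\mathfrak{B}^{\alpha}_{R}(f_1,f_2,f_3)(x)|$ be the trilinear maximal Bochner--Riesz mean on $\mathbb{R}$. Let $1<p_1,p_2,p_3<\infty$ and $\frac1p=\frac1{p_1}+\frac1{p_2}+\frac1{p_3}$. Suppose that one of the following holds: 1. $p_1,p_2,p_3\ge 2$ and $\alpha>\frac12$; 2. for some $i,j,k$ with $\{i,j,k\}=\{1,2,3\}$: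 $1<p_i<2$, $2\le p_j,p_k<\infty$ and $\alpha>\frac1{p_i}$; 3. for some $i,j,k$ with $\{i,j,k\}=\{1,2,3\}$: $1<p_i,p_j<2$, $2\le p_k<\infty$ and $\alpha>\frac1{p_i}+\frac1{p_j}-\frac12$; 4. $1<p_1,p_2,p_3<2$ and $\alpha>\frac1p-1$. Then there is a constant $C<\infty$, depending only on $\alpha,p_1,p_2,p_3$, such that \[ \big\|\mathfrak{B}^{\alpha}_{*}(f_1,f_2,f_3)\big\|_{L^{p}(\mathbb{R})}\le C\,\|f_1\|_{L^{p_1}(\mathbb{R})}\|f_2\|_{L^{p_2}(\mathbb{R})}\|f_3\|_{L^{p_3}(\mathbb{R})} \] for all Schwartz functions $f_1,f_2,f_3$ on $\mathbb{R}$. -/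

import Mathlib

open MeasureTheory
open scoped NNReal ENNReal FourierTransform SchwartzMap

noncomputable section

namespace BochnerRiesz

/-- The multiplier `(1 - |ξ|² / R²)₊ ^ α` on `ℝ^m`, where `|ξ|² = ξ₁² + ⋯ + ξ_m²` and
`r₊ = max r 0`. -/
def multiplier {m : ℕ} (α R : ℝ) (ξ : Fin m → ℝ) : ℝ :=
  (max (1 - (∑ i, ξ i ^ 2) / R ^ 2) 0) ^ α

/-- The `m`-linear Bochner–Riesz mean on `ℝ`, for Schwartz functions `f₁, …, f_m`:
`∫_{ℝ^m} (1 - |ξ|² / R²)₊ ^ α ∏ᵢ f̂ᵢ(ξᵢ) e^{2πi x (ξ₁ + ⋯ + ξ_m)} dξ`,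
with `f̂(ξ) = ∫ f(x) e^{-2πi x ξ} dx`. -/
def mean {m : ℕ} (α R : ℝ) (f : Fin m → 𝓢(ℝ, ℂ)) (x : ℝ) : ℂ :=
  ∫ ξ : Fin m → ℝ, (multiplier α R ξ : ℂ) * (∏ i, 𝓕 (f i : ℝ → ℂ) (ξ i)) *
    Complex.exp (2 * Real.pi * Complex.I * (x * ∑ i, ξ i : ℝ))

/-- The maximal `m`-linear Bochner–Riesz mean `sup_{R > 0} |mean α R f x|`, as an extended
nonnegative real. -/
def maximalMean {m : ℕ} (α : ℝ) (f : Fin m → 𝓢(ℝ, ℂ)) (x : ℝ) : ℝ≥0∞ :=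
  ⨆ (R : ℝ) (_ : 0 < R), ‖mean α R f x‖ₑ

end BochnerRiesz

end

/-! Dirichlet's integral writes `(1 - |ξ|²)₊ ^ α` as a constant times the integral over `s` of `(1 -
∑ sᵢ)₊ ^ γ ∏ (sᵢ - ξᵢ²)₊ ^ δᵢ`, where `γ = α - ∑ (δᵢ + 1)` (`exists_lintegral_prod_posPow`). After
rescaling, the mean at `x` with radius `R` is therefore an average over the simplex of products `∏
Tᵢ gᵢ (sᵢ)`, where `gᵢ(y) = fᵢ(x + y / R)` and `Tᵢ g(u) = ∫ (u - η²)₊ ^ δᵢ ĝ(η) dη` is a linear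
Bochner–Riesz mean at the origin. Since `γ > -1`, the weight is integrable, and a Young inequality
(`lintegral_simplex_le`) leaves the norms of the `Tᵢ gᵢ` in `L^{3/2}(0, 1)`.

The linear estimate is `exists_eLpNorm_rieszKernel_le`. Row and column bounds for the kernel give a
weighted `L²` bound for `T`, from `L¹` trivially and from `L²` by Plancherel; splitting at one
height gives all `1 ≤ s ≤ 2`. If `g` lives on `|y| ∼ 1/τ`, it equals `(e^{2πiyτ} - 1) h` with `|h| ≤
|g|`, which replaces the kernel by its difference under translation by `τ` and gains `τ ^ (δ + 1)`.
The dyadic pieces sum when `1/s < 1 + δ`, so `Tᵢ gᵢ` is controlled by `M(|fᵢ| ^ s)(x) ^ (1/s)`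
uniformly in `R`.

Thus the maximal mean is dominated pointwise by a product of such maximal functions
(`exists_maximalMean_le`). Hölder and the Hardy–Littlewood theorem on `L^{pᵢ/sᵢ}` finish. With `δᵢ`
and `1/sᵢ` slightly above `max(1/pᵢ, 1/2) - 1` and `max(1/pᵢ, 1/2)`, the requirement `γ > -1`
becomes `α > ∑ max(1/pᵢ, 1/2) - 1`, which is what the four cases say. -/

namespace BochnerRiesz

/-! ### Truncated powers and Dirichlet's integral. -/

/-- The truncated power `x₊ ^ a`, with value `0` for `x ≤ 0` whatever the exponent. -/
noncomputable def posPow (a x : ℝ) : ℝ := if 0 < x then x ^ a else 0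

lemma posPow_of_pos {a x : ℝ} (hx : 0 < x) : posPow a x = x ^ a := if_pos hx

lemma posPow_of_nonpos {a x : ℝ} (hx : x ≤ 0) : posPow a x = 0 := if_neg hx.not_gt

lemma posPow_nonneg (a x : ℝ) : 0 ≤ posPow a x := by
  unfold posPow
  split_ifs with h
  · positivity
  · rfl

lemma measurable_posPow (a : ℝ) : Measurable (posPow a) :=
  Measurable.ite measurableSet_Ioi (by fun_prop) measurable_const

lemma posPow_mul {a c : ℝ} (hc : 0 < c) (x : ℝ) : posPow a (c * x) = c ^ a * posPow a x := by
  rcases lt_or_ge 0 x with hx | hx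
  · rw [posPow_of_pos hx, posPow_of_pos (mul_pos hc hx), Real.mul_rpow hc.le hx.le]
  · rw [posPow_of_nonpos hx, posPow_of_nonpos (mul_nonpos_of_nonneg_of_nonpos hc.le hx), mul_zero]

lemma lintegral_eq_mul_lintegral_comp_mul {c : ℝ} (hc : 0 < c) {f : ℝ → ℝ≥0∞}
    (hf : Measurable f) : ∫⁻ x, f x = ENNReal.ofReal c * ∫⁻ x, f (c * x) := by
  conv_lhs => rw [← Real.smul_map_volume_mul_left hc.ne']
  rw [lintegral_smul_measure, lintegral_map hf (by fun_prop), abs_of_pos hc, smul_eq_mul]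

/-- The substitution `s ↦ x + (y - x) s` turns the integrand into a multiple of the beta density,
whose total mass is one. -/
lemma lintegral_posPow_mul_posPow {a b : ℝ} (ha : -1 < a) (hb : -1 < b) (x y : ℝ) :
    ∫⁻ s, ENNReal.ofReal (posPow a (s - x)) * ENNReal.ofReal (posPow b (y - s)) =
      ENNReal.ofReal (ProbabilityTheory.beta (a + 1) (b + 1)) *
        ENNReal.ofReal (posPow (a + b + 1) (y - x)) := by
  have hB : 0 < ProbabilityTheory.beta (a + 1) (b + 1) :=
    ProbabilityTheory.beta_pos (by linarith) (by linarith)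
  rcases le_or_gt y x with hyx | hxy
  · rw [posPow_of_nonpos (sub_nonpos.2 hyx)]
    simp only [ENNReal.ofReal_zero, mul_zero]
    rw [lintegral_eq_zero_iff' (by have := measurable_posPow a; have := measurable_posPow b; fun_prop)]
    filter_upwards with s
    rcases le_or_gt s x with h | h
    · simp [posPow_of_nonpos (sub_nonpos.2 h)]
    · simp [posPow_of_nonpos (show y - s ≤ 0 by linarith)]
  · have hL : 0 < y - x := sub_pos.2 hxy
    rw [← lintegral_add_right_eq_self _ x]
    have hm : Measurable fun s => ENNReal.ofReal (posPow a (s + x - x)) *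
        ENNReal.ofReal (posPow b (y - (s + x))) := by
      have := measurable_posPow a; have := measurable_posPow b; fun_prop
    rw [lintegral_eq_mul_lintegral_comp_mul hL hm]
    have key : ∀ s : ℝ, ENNReal.ofReal (posPow a ((y - x) * s + x - x)) *
        ENNReal.ofReal (posPow b (y - ((y - x) * s + x))) =
        ENNReal.ofReal ((y - x) ^ (a + b) * ProbabilityTheory.beta (a + 1) (b + 1)) *
          ProbabilityTheory.betaPDF (a + 1) (b + 1) s := by
      intro s
      rw [show (y - x) * s + x - x = (y - x) * s by ring,
        show y - ((y - x) * s + x) = (y - x) * (1 - s) by ring, posPow_mul hL, posPow_mul hL,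
        ProbabilityTheory.betaPDF, ← ENNReal.ofReal_mul (by positivity [posPow_nonneg a s]),
        ← ENNReal.ofReal_mul (by positivity)]
      congr 1
      rw [ProbabilityTheory.betaPDFReal, Real.rpow_add hL]
      split_ifs with h
      · rw [posPow_of_pos h.1, posPow_of_pos (sub_pos.2 h.2)]
        field_simp
        simp only [add_sub_cancel_right]
      · rw [not_and_or] at h
        rcases h with h | h
        · simp [posPow_of_nonpos (not_lt.1 h)]
        · simp [posPow_of_nonpos (show 1 - s ≤ 0 by linarith)]
    simp_rw [key]
    rw [lintegral_const_mul' _ _ ENNReal.ofReal_ne_top,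
      ProbabilityTheory.lintegral_betaPDF_eq_one (by linarith) (by linarith), mul_one,
      ← ENNReal.ofReal_mul hL.le, ← ENNReal.ofReal_mul hB.le, posPow_of_pos hL,
      Real.rpow_add hL (a + b), Real.rpow_one]
    congr 1
    ring

/-- Dirichlet's integral: the truncated power of `b - ∑ aᵢ` is an average of products of truncated
powers of the single variables. -/
lemma exists_lintegral_prod_posPow (m : ℕ) : ∀ (δ : Fin m → ℝ) (γ : ℝ), (∀ i, -1 < δ i) →
    -1 < γ → ∃ C : ℝ≥0, C ≠ 0 ∧ ∀ (a : Fin m → ℝ) (b : ℝ),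
      ∫⁻ s : Fin m → ℝ, ENNReal.ofReal (posPow γ (b - ∑ i, s i)) *
          ∏ i, ENNReal.ofReal (posPow (δ i) (s i - a i)) =
        C * ENNReal.ofReal (posPow (γ + ∑ i, (δ i + 1)) (b - ∑ i, a i)) := by
  induction m with
  | zero =>
    intro δ γ _ _
    refine ⟨1, one_ne_zero, fun a b => ?_⟩
    simp [volume_pi]
  | succ m ih =>
    intro δ γ hδ hγ
    obtain ⟨C, hC, hi⟩ := ih (fun i => δ i.succ) γ (fun i => hδ _) hγ
    have hγ' : -1 < γ + ∑ i : Fin m, (δ i.succ + 1) := by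
      have : 0 ≤ ∑ i : Fin m, (δ i.succ + 1) :=
        Finset.sum_nonneg fun i _ => by linarith [hδ i.succ]
      linarith
    have hB := ProbabilityTheory.beta_pos (α := δ 0 + 1)
      (β := (γ + ∑ i : Fin m, (δ i.succ + 1)) + 1) (by linarith [hδ 0]) (by linarith)
    refine ⟨C * (ProbabilityTheory.beta (δ 0 + 1)
      ((γ + ∑ i : Fin m, (δ i.succ + 1)) + 1)).toNNReal, mul_ne_zero hC ?_, fun a b => ?_⟩
    · simpa using hB
    have hmp := (volume_preserving_piFinSuccAbove (fun _ : Fin (m + 1) => ℝ) 0).symm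
    rw [← hmp.lintegral_comp_emb (MeasurableEquiv.measurableEmbedding _)]
    have hpm : ∀ a, Measurable (posPow a) := measurable_posPow
    have hmeas : Measurable fun s : Fin (m + 1) → ℝ =>
        ENNReal.ofReal (posPow γ (b - ∑ i, s i)) *
          ∏ i, ENNReal.ofReal (posPow (δ i) (s i - a i)) := by
      refine Measurable.mul ?_ (Finset.measurable_prod _ fun i _ => ?_)
      · exact ((hpm γ).comp (by fun_prop)).ennreal_ofReal
      · exact ((hpm _).comp (by fun_prop)).ennreal_ofReal
    rw [Measure.volume_eq_prod, lintegral_prod]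
    swap
    · exact (hmeas.comp (MeasurableEquiv.measurable _)).aemeasurable
    -- With the first coordinate fixed, the remaining ones are integrated by induction with `b - x`
    -- in place of `b`; what is left is the two-factor beta integral.
    have step : ∀ x : ℝ, ∫⁻ y : Fin m → ℝ,
        (ENNReal.ofReal (posPow γ (b - ∑ i, ((MeasurableEquiv.piFinSuccAbove
          (fun _ : Fin (m + 1) => ℝ) 0).symm (x, y)) i)) *
          ∏ i, ENNReal.ofReal (posPow (δ i) (((MeasurableEquiv.piFinSuccAbove
          (fun _ : Fin (m + 1) => ℝ) 0).symm (x, y)) i - a i))) =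
        C * (ENNReal.ofReal (posPow (δ 0) (x - a 0)) *
          ENNReal.ofReal (posPow (γ + ∑ i : Fin m, (δ i.succ + 1))
            ((b - ∑ i : Fin m, a i.succ) - x))) := by
      intro x
      simp only [MeasurableEquiv.piFinSuccAbove_symm_apply, Fin.insertNthEquiv_zero,
        Fin.consEquiv_apply, Fin.sum_univ_succ, Fin.prod_univ_succ, Fin.cons_zero, Fin.cons_succ]
      have := hi (fun i => a i.succ) (b - x)
      rw [show b - ∑ i : Fin m, a i.succ - x = b - x - ∑ i : Fin m, a i.succ by ring,
        mul_left_comm, ← this, ← lintegral_const_mul']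
      · congr 1 with y
        rw [show b - (x + ∑ i, y i) = b - x - ∑ i, y i by ring]
        ring
      · exact ENNReal.ofReal_ne_top
    simp_rw [step]
    rw [lintegral_const_mul' _ _ ENNReal.coe_ne_top,
      lintegral_posPow_mul_posPow (hδ 0) hγ', Fin.sum_univ_succ, Fin.sum_univ_succ,
      ENNReal.coe_mul, mul_assoc]
    congr 3
    rw [show δ 0 + (γ + ∑ i : Fin m, (δ i.succ + 1)) + 1 = γ + (δ 0 + 1 + ∑ i : Fin m,
      (δ i.succ + 1)) by ring, show b - ∑ i : Fin m, a i.succ - a 0 =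
      b - (a 0 + ∑ i : Fin m, a i.succ) by ring]

/-! ### The Hardy–Littlewood maximal theorem. -/

/-- The Hardy–Littlewood maximal function on `ℝ`, normalised by the radius. -/
noncomputable def hlMaximal (f : ℝ → ℝ≥0∞) (x : ℝ) : ℝ≥0∞ :=
  ⨆ (r : ℝ) (_ : 0 < r), (ENNReal.ofReal r)⁻¹ * ∫⁻ y in Metric.closedBall x r, f y

lemma lintegral_closedBall_le_hlMaximal (f : ℝ → ℝ≥0∞) (x : ℝ) {r : ℝ} (hr : 0 < r) :
    ∫⁻ y in Metric.closedBall x r, f y ≤ ENNReal.ofReal r * hlMaximal f x := by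
  have h : (ENNReal.ofReal r)⁻¹ * ∫⁻ y in Metric.closedBall x r, f y ≤ hlMaximal f x :=
    le_iSup₂ (f := fun (r : ℝ) (_ : 0 < r) =>
      (ENNReal.ofReal r)⁻¹ * ∫⁻ y in Metric.closedBall x r, f y) r hr
  have h0 : ENNReal.ofReal r ≠ 0 := by simpa using hr
  calc _ = ENNReal.ofReal r * ((ENNReal.ofReal r)⁻¹ * ∫⁻ y in Metric.closedBall x r, f y) := by
        rw [← mul_assoc, ENNReal.mul_inv_cancel h0 ENNReal.ofReal_ne_top, one_mul]
    _ ≤ _ := by gcongr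

lemma lt_hlMaximal_iff {f : ℝ → ℝ≥0∞} {x : ℝ} {l : ℝ≥0∞} :
    l < hlMaximal f x ↔
      ∃ r : ℝ, 0 < r ∧ l * ENNReal.ofReal r < ∫⁻ y in Metric.closedBall x r, f y := by
  simp only [hlMaximal, lt_iSup_iff, exists_prop]
  refine exists_congr fun r => and_congr_right fun hr => ?_
  have h0 : ENNReal.ofReal r ≠ 0 := by simpa using hr
  rw [mul_comm _ (∫⁻ y in Metric.closedBall x r, f y), ← div_eq_mul_inv,
    ENNReal.lt_div_iff_mul_lt (Or.inl h0) (Or.inl ENNReal.ofReal_ne_top)]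

/-- A strict inequality for one ball survives a small increase of its radius, and the enlarged ball
about a nearby centre contains the original one. Measurability of the maximal function comes from
here. -/
lemma lowerSemicontinuous_hlMaximal (f : ℝ → ℝ≥0∞) : LowerSemicontinuous (hlMaximal f) := by
  intro x l hl
  obtain ⟨r, hr, h⟩ := lt_hlMaximal_iff.1 hl
  have hl' : l ≠ ⊤ := hl.ne_top
  have hc : Continuous fun r : ℝ => l * ENNReal.ofReal r :=
    ENNReal.continuous_const_mul hl' |>.comp ENNReal.continuous_ofReal
  obtain ⟨ε, hε, hball⟩ := Metric.mem_nhds_iff.1 (hc.continuousAt.eventually_lt_const h)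
  filter_upwards [Metric.ball_mem_nhds x (half_pos hε)] with x' hx'
  refine lt_hlMaximal_iff.2 ⟨r + ε / 2, by positivity, ?_⟩
  have : l * ENNReal.ofReal (r + ε / 2) < ∫⁻ y in Metric.closedBall x r, f y :=
    hball (by simp [abs_of_pos, hε])
  refine this.trans_le (lintegral_mono_set (Metric.closedBall_subset_closedBall' ?_))
  rw [Metric.mem_ball, dist_comm] at hx'
  linarith

lemma measurable_hlMaximal (f : ℝ → ℝ≥0∞) : Measurable (hlMaximal f) :=
  (lowerSemicontinuous_hlMaximal f).measurable

/-- Vitali covering: the radii are bounded because `l * r` is at most the finite integral of `f`.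
The constant `10` is the enlargement factor `5` times the length `2 r` of an interval of radius `r`.
-/
lemma volume_lt_hlMaximal_le (f : ℝ → ℝ≥0∞) {l : ℝ≥0∞} (hl : l ≠ 0) :
    l * volume {x | l < hlMaximal f x} ≤ 10 * ∫⁻ y, f y := by
  rcases eq_or_ne (∫⁻ y, f y) ⊤ with hf | hf
  · simp [hf]
  rcases eq_or_ne l ⊤ with rfl | hl'
  · simp
  have hex : ∀ x ∈ {x | l < hlMaximal f x}, ∃ r : ℝ, 0 < r ∧
      l * ENNReal.ofReal r < ∫⁻ y in Metric.closedBall x r, f y :=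
    fun x hx => lt_hlMaximal_iff.1 hx
  choose! r hr0 hr using hex
  have hbd : ∀ x ∈ {x | l < hlMaximal f x}, r x ≤ ((∫⁻ y, f y) / l).toReal := by
    intro x hx
    have h1 : l * ENNReal.ofReal (r x) ≤ ∫⁻ y, f y :=
      (hr x hx).le.trans (setLIntegral_le_lintegral _ _)
    rw [mul_comm, ← ENNReal.le_div_iff_mul_le (Or.inl hl) (Or.inl hl')] at h1
    exact (ENNReal.ofReal_le_iff_le_toReal (ENNReal.div_ne_top hf hl)).1 h1
  obtain ⟨u, hu, hdisj, hcov⟩ := Vitali.exists_disjoint_subfamily_covering_enlargement_closedBall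
    {x | l < hlMaximal f x} id r _ hbd 5 (by norm_num)
  simp only [id] at hdisj hcov
  have hcount : u.Countable := by
    refine hdisj.countable_of_nonempty_interior fun x hx => ?_
    rw [interior_closedBall _ (hr0 x (hu hx)).ne']
    exact Metric.nonempty_ball.2 (hr0 x (hu hx))
  have hsub : {x | l < hlMaximal f x} ⊆ ⋃ b ∈ u, Metric.closedBall b (5 * r b) := by
    intro x hx
    obtain ⟨b, hb, hxb⟩ := hcov x hx
    exact Set.mem_biUnion hb (hxb (Metric.mem_closedBall_self (hr0 x hx).le))
  have : Countable u := hcount.to_subtype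
  calc l * volume {x | l < hlMaximal f x}
      ≤ l * ∑' b : u, volume (Metric.closedBall (b : ℝ) (5 * r b)) := by
        gcongr
        exact (measure_mono hsub).trans (measure_biUnion_le _ hcount _)
    _ = ∑' b : u, 10 * (l * ENNReal.ofReal (r b)) := by
        rw [← ENNReal.tsum_mul_left]
        congr 1 with b
        rw [Real.volume_closedBall, show 2 * (5 * r b) = 10 * r b by ring,
          ENNReal.ofReal_mul (by norm_num), mul_left_comm]
        norm_num
    _ ≤ ∑' b : u, 10 * ∫⁻ y in Metric.closedBall (b : ℝ) (r b), f y := by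
        gcongr with b
        exact (hr b (hu b.2)).le
    _ = 10 * ∫⁻ y in ⋃ b ∈ u, Metric.closedBall b (r b), f y := by
        rw [ENNReal.tsum_mul_left, lintegral_biUnion hcount
          (fun _ _ => Metric.isClosed_closedBall.measurableSet) hdisj]
    _ ≤ _ := by
        gcongr
        exact Measure.restrict_le_self

lemma lintegral_Ioo_rpow {a b : ℝ} (ha : -1 < a) (hb : 0 ≤ b) :
    ∫⁻ t in Set.Ioo 0 b, ENNReal.ofReal (t ^ a) = ENNReal.ofReal (b ^ (a + 1) / (a + 1)) := by
  have hi : IntervalIntegrable (fun t : ℝ => t ^ a) volume 0 b :=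
    intervalIntegral.intervalIntegrable_rpow' ha
  rw [restrict_Ioo_eq_restrict_Ioc, ← ofReal_integral_eq_lintegral_ofReal,
    ← intervalIntegral.integral_of_le hb, integral_rpow (Or.inl ha),
    Real.zero_rpow (by linarith), sub_zero]
  · exact (intervalIntegrable_iff_integrableOn_Ioc_of_le hb).1 hi
  · filter_upwards [ae_restrict_mem measurableSet_Ioc] with t ht
    exact Real.rpow_nonneg ht.1.le _

/-- Layer-cake formula for a single value, including `a = ⊤`, where both sides are infinite. -/
lemma lintegral_rpow_lt {p : ℝ} (hp : 0 < p) (a : ℝ≥0∞) :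
    ∫⁻ t in {t : ℝ | 0 < t ∧ ENNReal.ofReal t < a}, ENNReal.ofReal (t ^ (p - 1)) =
      ENNReal.ofReal p⁻¹ * a ^ p := by
  have hfin : ∀ b : ℝ, 0 ≤ b →
      ∫⁻ t in Set.Ioo 0 b, ENNReal.ofReal (t ^ (p - 1)) = ENNReal.ofReal p⁻¹ * ENNReal.ofReal b ^ p := by
    intro b hb
    rw [lintegral_Ioo_rpow (by linarith) hb, ENNReal.ofReal_rpow_of_nonneg hb hp.le,
      ← ENNReal.ofReal_mul (by positivity), sub_add_cancel, div_eq_inv_mul]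
  induction a with
  | coe a =>
    have : {t : ℝ | 0 < t ∧ ENNReal.ofReal t < (a : ℝ≥0∞)} = Set.Ioo 0 (a : ℝ) := by
      ext t
      simp only [Set.mem_ofPred_eq, Set.mem_Ioo, and_congr_right_iff]
      intro ht
      rw [← ENNReal.ofReal_coe_nnreal]
      exact ENNReal.ofReal_lt_ofReal_iff_of_nonneg ht.le
    rw [this, hfin a a.2, ENNReal.ofReal_coe_nnreal]
  | top =>
    rw [ENNReal.top_rpow_of_pos hp, ENNReal.mul_top (by simpa using hp)]
    refine ENNReal.eq_top_of_forall_nnreal_le fun c => ?_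
    have hb := hfin ((p * c) ^ p⁻¹) (by positivity)
    rw [ENNReal.ofReal_rpow_of_nonneg (by positivity) hp.le, ← Real.rpow_mul (by positivity),
      inv_mul_cancel₀ hp.ne', Real.rpow_one, ← ENNReal.ofReal_mul (by positivity),
      inv_mul_cancel_left₀ hp.ne', ENNReal.ofReal_coe_nnreal] at hb
    rw [← hb]
    exact lintegral_mono_set fun t ht => ⟨ht.1, ENNReal.ofReal_lt_top⟩

/-- The part of `f` below height `l` contributes at most `2 * l`, as averages are normalised by the
radius and not by the length. -/
lemma hlMaximal_le_add (f : ℝ → ℝ≥0∞) (l : ℝ≥0∞) (x : ℝ) :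
    hlMaximal f x ≤ hlMaximal ({y | l < f y}.indicator f) x + 2 * l := by
  refine iSup₂_le fun r hr => ?_
  have h0 : ENNReal.ofReal r ≠ 0 := by simpa using hr
  have hle : ∀ y, f y ≤ {y | l < f y}.indicator f y + l := by
    intro y
    by_cases hy : l < f y
    · rw [Set.indicator_of_mem (by exact hy)]
      exact le_self_add
    · exact (not_lt.1 hy).trans le_add_self
  calc (ENNReal.ofReal r)⁻¹ * ∫⁻ y in Metric.closedBall x r, f y
      ≤ (ENNReal.ofReal r)⁻¹ *
        ∫⁻ y in Metric.closedBall x r, ({y | l < f y}.indicator f y + l) := by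
        gcongr with y
        exact hle y
    _ = (ENNReal.ofReal r)⁻¹ * (∫⁻ y in Metric.closedBall x r, {y | l < f y}.indicator f y) +
        (ENNReal.ofReal r)⁻¹ * (l * ENNReal.ofReal (2 * r)) := by
        rw [lintegral_add_right _ measurable_const, mul_add, setLIntegral_const,
          Real.volume_closedBall]
    _ ≤ _ := by
        refine add_le_add ?_ (le_of_eq ?_)
        · exact le_iSup₂ (f := fun (r : ℝ) (_ : 0 < r) => (ENNReal.ofReal r)⁻¹ *
            ∫⁻ y in Metric.closedBall x r, {y | l < f y}.indicator f y) r hr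
        · rw [ENNReal.ofReal_mul (by norm_num), mul_left_comm, mul_left_comm _ (ENNReal.ofReal 2),
            ENNReal.inv_mul_cancel h0 ENNReal.ofReal_ne_top]
          simp [mul_comm]

lemma volume_lt_hlMaximal_le_truncated {f : ℝ → ℝ≥0∞} (hf : Measurable f) {t : ℝ} (ht : 0 < t) :
    volume {x | ENNReal.ofReal t < hlMaximal f x} ≤
      20 * ENNReal.ofReal t⁻¹ * ∫⁻ y in {y | ENNReal.ofReal t < 4 * f y}, f y := by
  -- At height `t / 4` the low part contributes at most `t / 2`, so the high part alone must exceed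
  -- `t / 2`.
  set l := ENNReal.ofReal (t / 4) with hl
  have hset : {y | ENNReal.ofReal t < 4 * f y} = {y | l < f y} := by
    ext y
    simp only [Set.mem_ofPred_eq, hl]
    rw [show t / 4 = t * (4 : ℝ)⁻¹ by ring, ENNReal.ofReal_mul ht.le,
      ENNReal.ofReal_inv_of_pos (by norm_num), ← div_eq_mul_inv, ENNReal.div_lt_iff (by simp) (by simp)]
    norm_num [mul_comm]
  have hsub : {x | ENNReal.ofReal t < hlMaximal f x} ⊆
      {x | ENNReal.ofReal (t / 2) < hlMaximal ({y | l < f y}.indicator f) x} := by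
    intro x hx
    by_contra hcon
    have h := (hx.trans_le (hlMaximal_le_add f l x)).trans_le
      (add_le_add_left (not_lt.1 hcon) (2 * l))
    rw [hl, show (2 : ℝ≥0∞) = ENNReal.ofReal 2 by norm_num, ← ENNReal.ofReal_mul (by norm_num),
      ← ENNReal.ofReal_add (by positivity) (by positivity)] at h
    ring_nf at h
    exact lt_irrefl _ h
  have hw := volume_lt_hlMaximal_le ({y | l < f y}.indicator f) (l := ENNReal.ofReal (t / 2))
    (by simpa using ht)
  rw [lintegral_indicator (measurableSet_lt measurable_const hf)] at hw
  have hinv : 20 * ENNReal.ofReal t⁻¹ = (ENNReal.ofReal (t / 2))⁻¹ * 10 := by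
    rw [← ENNReal.ofReal_inv_of_pos (by positivity), show (20 : ℝ≥0∞) = ENNReal.ofReal 20 by norm_num,
      show (10 : ℝ≥0∞) = ENNReal.ofReal 10 by norm_num, ← ENNReal.ofReal_mul (by norm_num),
      ← ENNReal.ofReal_mul (by positivity)]
    congr 1
    field_simp
    norm_num
  calc volume {x | ENNReal.ofReal t < hlMaximal f x}
      ≤ volume {x | ENNReal.ofReal (t / 2) < hlMaximal ({y | l < f y}.indicator f) x} :=
        measure_mono hsub
    _ = (ENNReal.ofReal (t / 2))⁻¹ * (ENNReal.ofReal (t / 2) *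
          volume {x | ENNReal.ofReal (t / 2) < hlMaximal ({y | l < f y}.indicator f) x}) := by
        rw [← mul_assoc, ENNReal.inv_mul_cancel (by simpa using ht) ENNReal.ofReal_ne_top, one_mul]
    _ ≤ _ := by
        rw [hinv, mul_assoc]
        exact mul_le_mul' le_rfl (by rwa [hset])

/-- The Hardy–Littlewood maximal theorem on `ℝ`. -/
theorem exists_lintegral_hlMaximal_rpow_le {p : ℝ} (hp : 1 < p) :
    ∃ C : ℝ≥0, ∀ f : ℝ → ℝ≥0∞, Measurable f →
      ∫⁻ x, hlMaximal f x ^ p ≤ C * ∫⁻ x, f x ^ p := by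
  refine ⟨p.toNNReal * 20 * (p - 1)⁻¹.toNNReal * 4 ^ (p - 1), fun f hf => ?_⟩
  have hp0 : 0 < p := by linarith
  have hlayer : ∀ {q : ℝ}, 0 < q → ∀ g : ℝ → ℝ≥0∞, ∀ x, g x ^ q = ENNReal.ofReal q *
      ∫⁻ t in Set.Ioi (0 : ℝ), {z : ℝ × ℝ | ENNReal.ofReal z.1 < g z.2}.indicator
        (fun z => ENNReal.ofReal (z.1 ^ (q - 1))) (t, x) := by
    intro q hq g x
    have h := lintegral_rpow_lt hq (g x)
    have hs : {t : ℝ | 0 < t ∧ ENNReal.ofReal t < g x} = {t : ℝ | ENNReal.ofReal t < g x} ∩ Set.Ioi 0 := by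
      ext; simp [and_comm]
    rw [hs, ← Measure.restrict_restrict (measurableSet_lt (by fun_prop) measurable_const),
      ← lintegral_indicator (measurableSet_lt (by fun_prop) measurable_const)] at h
    have h2 : ∀ t : ℝ, {z : ℝ × ℝ | ENNReal.ofReal z.1 < g z.2}.indicator
        (fun z => ENNReal.ofReal (z.1 ^ (q - 1))) (t, x) =
        {t : ℝ | ENNReal.ofReal t < g x}.indicator (fun t => ENNReal.ofReal (t ^ (q - 1))) t :=
      fun t => rfl
    simp_rw [h2]
    rw [h, ← mul_assoc, ← ENNReal.ofReal_mul hq.le, mul_inv_cancel₀ hq.ne', ENNReal.ofReal_one,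
      one_mul]
  have hmeas : ∀ {q : ℝ} {g : ℝ → ℝ≥0∞}, Measurable g → Measurable
      ({z : ℝ × ℝ | ENNReal.ofReal z.1 < g z.2}.indicator
        (fun z => ENNReal.ofReal (z.1 ^ (q - 1)))) := fun {q g} hg =>
    Measurable.indicator (by fun_prop)
      (measurableSet_lt (by fun_prop) (hg.comp measurable_snd))
  have h4 : Measurable fun y => 4 * f y := by fun_prop
  calc ∫⁻ x, hlMaximal f x ^ p
      = ENNReal.ofReal p * ∫⁻ t in Set.Ioi (0 : ℝ), ∫⁻ x,
          {z : ℝ × ℝ | ENNReal.ofReal z.1 < hlMaximal f z.2}.indicator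
          (fun z => ENNReal.ofReal (z.1 ^ (p - 1))) (t, x) := by
        simp_rw [hlayer hp0 (hlMaximal f)]
        rw [lintegral_const_mul' _ _ ENNReal.ofReal_ne_top, lintegral_lintegral_swap]
        exact ((hmeas (measurable_hlMaximal f)).comp measurable_swap).aemeasurable
    _ = ENNReal.ofReal p * ∫⁻ t in Set.Ioi (0 : ℝ), ENNReal.ofReal (t ^ (p - 1)) *
          volume {x | ENNReal.ofReal t < hlMaximal f x} := by
        congr 2 with t
        rw [← setLIntegral_const, ← lintegral_indicator
          (measurableSet_lt measurable_const (measurable_hlMaximal f))]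
        rfl
    -- The weak-type factor `t⁻¹` lowers the exponent to `p - 2`. Integrating in `t` first is then
    -- the layer-cake formula with exponent `p - 1`, positive because `1 < p`.
    _ ≤ ENNReal.ofReal p * ∫⁻ t in Set.Ioi (0 : ℝ), 20 * ∫⁻ x, f x *
          {z : ℝ × ℝ | ENNReal.ofReal z.1 < 4 * f z.2}.indicator
          (fun z => ENNReal.ofReal (z.1 ^ (p - 1 - 1))) (t, x) := by
        gcongr ENNReal.ofReal p * ?_
        refine setLIntegral_mono' measurableSet_Ioi fun t (ht : 0 < t) => ?_
        have hpow : ENNReal.ofReal (t ^ (p - 1 - 1)) =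
            ENNReal.ofReal (t ^ (p - 1)) * ENNReal.ofReal t⁻¹ := by
          rw [← ENNReal.ofReal_mul (by positivity), Real.rpow_sub_one ht.ne' (p - 1), div_eq_mul_inv]
        have hin : ∫⁻ x, f x * {z : ℝ × ℝ | ENNReal.ofReal z.1 < 4 * f z.2}.indicator
            (fun z => ENNReal.ofReal (z.1 ^ (p - 1 - 1))) (t, x) =
            ENNReal.ofReal (t ^ (p - 1 - 1)) * ∫⁻ y in {y | ENNReal.ofReal t < 4 * f y}, f y := by
          rw [← lintegral_indicator (measurableSet_lt measurable_const h4),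
            ← lintegral_const_mul' _ _ ENNReal.ofReal_ne_top]
          congr 1 with x
          by_cases hx : ENNReal.ofReal t < 4 * f x
          · simp [Set.indicator, mul_comm]
          · simp [Set.indicator, hx]
        rw [hin, hpow]
        calc _ ≤ ENNReal.ofReal (t ^ (p - 1)) * (20 * ENNReal.ofReal t⁻¹ *
              ∫⁻ y in {y | ENNReal.ofReal t < 4 * f y}, f y) := by
              gcongr
              exact volume_lt_hlMaximal_le_truncated hf ht
          _ = _ := by ring
    _ = ENNReal.ofReal p * (20 * ∫⁻ x, f x * (ENNReal.ofReal (p - 1)⁻¹ * (4 * f x) ^ (p - 1))) := by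
        rw [lintegral_const_mul' _ _ (by norm_num), lintegral_lintegral_swap]
        · congr 3 with x
          refine (lintegral_const_mul'' (f x)
            ((hmeas (q := p - 1) h4).comp measurable_prodMk_right).aemeasurable).trans ?_
          have := hlayer (q := p - 1) (by linarith) (fun y => 4 * f y) x
          rw [this, ← mul_assoc (ENNReal.ofReal (p - 1)⁻¹), ← ENNReal.ofReal_mul
            (inv_nonneg.2 (by linarith)), inv_mul_cancel₀ (by linarith), ENNReal.ofReal_one, one_mul]
          rfl
        · exact ((hf.comp measurable_snd).mul (hmeas h4)).aemeasurable
    _ = _ := by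
        have hpt : ∀ x, f x * (ENNReal.ofReal (p - 1)⁻¹ * (4 * f x) ^ (p - 1)) =
            ENNReal.ofReal (p - 1)⁻¹ * 4 ^ (p - 1) * f x ^ p := by
          intro x
          rw [ENNReal.mul_rpow_of_nonneg _ _ (by linarith)]
          have : f x ^ p = f x * f x ^ (p - 1) := by
            conv_rhs => rw [← ENNReal.rpow_one (f x), ← ENNReal.rpow_mul, one_mul]
            rw [← ENNReal.rpow_add_of_nonneg _ _ zero_le_one (by linarith)]
            ring_nf
          rw [this]
          ring
        simp_rw [hpt]
        rw [lintegral_const_mul _ (hf.pow_const p)]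
        push_cast
        rw [ENNReal.coe_rpow_of_nonneg _ (by linarith : (0 : ℝ) ≤ p - 1)]
        simp only [ENNReal.ofReal]
        push_cast
        ring

/-! ### Plancherel, and kernel operators acting on Fourier transforms. -/

/-- Both transforms agree when tested against compactly supported smooth functions: on each side the
transform moves onto the test function, by duality of tempered distributions on the `L²` side and by
Fubini on the `L¹` side. -/
lemma fourier_toLp_ae_eq {h : ℝ → ℂ} (h1 : Integrable h) (h2 : MemLp h 2) :
    (𝓕 (h2.toLp h) : Lp ℂ 2 (volume : Measure ℝ)) =ᵐ[volume] 𝓕 h := by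
  have hcont : Continuous (𝓕 h) := VectorFourier.fourierIntegral_continuous (L := innerₗ ℝ)
    Real.continuous_fourierChar continuous_inner h1
  refine ae_eq_of_integral_contDiff_smul_eq
    ((Lp.memLp _).locallyIntegrable (by norm_num)) hcont.locallyIntegrable fun g hg hgc => ?_
  have hgc' : HasCompactSupport fun x => (g x : ℂ) := hgc.comp_left (g := fun x : ℝ => (x : ℂ)) rfl
  have hg' : ContDiff ℝ (⊤ : ℕ∞) fun x => (g x : ℂ) := Complex.ofRealCLM.contDiff.comp hg
  let φ : 𝓢(ℝ, ℂ) := hgc'.toSchwartzMap hg'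
  have key := congrArg (fun T => T φ) (Lp.fourier_toTemperedDistribution_eq (h2.toLp h))
  simp only [TemperedDistribution.fourier_apply, Lp.toTemperedDistribution_apply] at key
  have hφ : ∀ x, φ x = g x := fun x => rfl
  have flip := VectorFourier.integral_fourierIntegral_smul_eq_flip (f := φ) (g := h)
    (μ := volume) (ν := volume) (L := innerₗ ℝ) (e := Real.fourierChar)
    Real.continuous_fourierChar continuous_inner φ.integrable h1
  rw [flip_innerₗ] at flip
  calc ∫ x, g x • (𝓕 (h2.toLp h) : Lp ℂ 2 (volume : Measure ℝ)) x
      = ∫ x, 𝓕 φ x • (h2.toLp h) x := by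
        rw [key]
        exact integral_congr_ae (Filter.Eventually.of_forall fun x => by simp [hφ])
    _ = ∫ x, 𝓕 φ x • h x := by
        refine integral_congr_ae ?_
        filter_upwards [h2.coeFn_toLp] with x hx
        rw [hx]
    _ = ∫ x, φ x • 𝓕 h x := by
        rw [SchwartzMap.fourier_coe]
        exact flip
    _ = _ := integral_congr_ae (Filter.Eventually.of_forall fun x => by simp [hφ])

lemma lintegral_enorm_fourier_sq {h : ℝ → ℂ} (h1 : Integrable h) (h2 : MemLp h 2) :
    ∫⁻ x, ‖𝓕 h x‖ₑ ^ (2 : ℝ) = ∫⁻ x, ‖h x‖ₑ ^ (2 : ℝ) := by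
  have e1 : eLpNorm (𝓕 h) 2 volume = eLpNorm h 2 volume := by
    rw [← eLpNorm_congr_ae (fourier_toLp_ae_eq h1 h2), ← Lp.enorm_def, ← eLpNorm_congr_ae h2.coeFn_toLp,
      ← Lp.enorm_def, ← ofReal_norm, ← ofReal_norm, Lp.norm_fourier_eq]
  rw [eLpNorm_eq_lintegral_rpow_enorm_toReal (by norm_num) (by norm_num),
    eLpNorm_eq_lintegral_rpow_enorm_toReal (by norm_num) (by norm_num)] at e1
  exact ENNReal.rpow_left_injective (by norm_num : (1 / (2 : ℝ≥0∞).toReal) ≠ 0) (by simpa using e1)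

lemma enorm_ofReal (x : ℝ) : ‖(x : ℂ)‖ₑ = ‖x‖ₑ := by
  rw [← ofReal_norm, ← ofReal_norm, Complex.norm_real]

/-- The operator with kernel `κ` applied to the Fourier transform of `h`. -/
noncomputable def fourierKernelOp (κ : ℝ → ℝ → ℝ) (h : ℝ → ℂ) (u : ℝ) : ℂ :=
  ∫ η, (κ u η : ℂ) * 𝓕 h η

lemma continuous_fourier {h : ℝ → ℂ} (h1 : Integrable h) : Continuous (𝓕 h) :=
  VectorFourier.fourierIntegral_continuous (L := innerₗ ℝ)
    Real.continuous_fourierChar continuous_inner h1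

lemma enorm_fourier_le (h : ℝ → ℂ) (x : ℝ) : ‖𝓕 h x‖ₑ ≤ ∫⁻ y, ‖h y‖ₑ := by
  rw [Real.fourier_eq]
  refine (enorm_integral_le_lintegral_enorm _).trans (le_of_eq ?_)
  congr 1 with y
  rw [← ofReal_norm, Circle.norm_smul, ofReal_norm]

lemma stronglyMeasurable_fourierKernelOp {κ : ℝ → ℝ → ℝ} (hκ : Measurable (Function.uncurry κ))
    {h : ℝ → ℂ} (h1 : Integrable h) : StronglyMeasurable (fourierKernelOp κ h) := by
  have hm : StronglyMeasurable (Function.uncurry fun u η : ℝ => (κ u η : ℂ) * 𝓕 h η) := by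
    refine Measurable.stronglyMeasurable (Measurable.mul ?_ ?_)
    · exact Complex.measurable_ofReal.comp hκ
    · exact (continuous_fourier h1).measurable.comp measurable_snd
  exact hm.integral_prod_right

lemma aestronglyMeasurable_fourierKernelOp {κ : ℝ → ℝ → ℝ} (hκ : Measurable (Function.uncurry κ))
    {h : ℝ → ℂ} (h1 : Integrable h) {μ : Measure ℝ} :
    AEStronglyMeasurable (fourierKernelOp κ h) μ :=
  (stronglyMeasurable_fourierKernelOp hκ h1).aestronglyMeasurable

/-- Row and column bounds for a kernel on `(0, 1) × ℝ`. -/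
structure KernelBound (κ : ℝ → ℝ → ℝ) (δ : ℝ) (B : ℝ≥0) : Prop where
  measurable : Measurable (Function.uncurry κ)
  row : ∀ u ∈ Set.Ioo (0 : ℝ) 1, ∫⁻ η, ‖κ u η‖ₑ ≤ B * ENNReal.ofReal (u ^ (δ / 2))
  col : ∀ η, ∫⁻ u in Set.Ioo (0 : ℝ) 1, ‖κ u η‖ₑ ≤ B

lemma KernelBound.integrable {κ : ℝ → ℝ → ℝ} {δ : ℝ} {B : ℝ≥0} (hκ : KernelBound κ δ B)
    {h : ℝ → ℂ} (h1 : Integrable h) {u : ℝ} (hu : u ∈ Set.Ioo (0 : ℝ) 1) :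
    Integrable fun η => (κ u η : ℂ) * 𝓕 h η := by
  have hm : Measurable (κ u) := hκ.measurable.comp measurable_prodMk_left
  refine ⟨((Complex.measurable_ofReal.comp hm).mul
    (continuous_fourier h1).measurable).aestronglyMeasurable, ?_⟩
  rw [hasFiniteIntegral_iff_enorm]
  calc ∫⁻ η, ‖(κ u η : ℂ) * 𝓕 h η‖ₑ ≤ ∫⁻ η, ‖κ u η‖ₑ * ∫⁻ y, ‖h y‖ₑ := by
        gcongr with η
        rw [enorm_mul, enorm_ofReal]
        gcongr
        exact enorm_fourier_le h η
    _ = (∫⁻ η, ‖κ u η‖ₑ) * ∫⁻ y, ‖h y‖ₑ := lintegral_mul_const _ (by fun_prop)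
    _ < ⊤ := ENNReal.mul_lt_top ((hκ.row u hu).trans_lt
        (ENNReal.mul_lt_top ENNReal.coe_lt_top ENNReal.ofReal_lt_top)) h1.2

lemma KernelBound.enorm_le {κ : ℝ → ℝ → ℝ} {δ : ℝ} {B : ℝ≥0} (hκ : KernelBound κ δ B)
    (h : ℝ → ℂ) {u : ℝ} (hu : u ∈ Set.Ioo (0 : ℝ) 1) :
    ‖fourierKernelOp κ h u‖ₑ ≤ B * ENNReal.ofReal (u ^ (δ / 2)) * ∫⁻ y, ‖h y‖ₑ := by
  have hm : Measurable (κ u) := hκ.measurable.comp measurable_prodMk_left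
  calc ‖fourierKernelOp κ h u‖ₑ ≤ ∫⁻ η, ‖(κ u η : ℂ) * 𝓕 h η‖ₑ :=
        enorm_integral_le_lintegral_enorm _
    _ ≤ ∫⁻ η, ‖κ u η‖ₑ * ∫⁻ y, ‖h y‖ₑ := by
        gcongr with η
        rw [enorm_mul, enorm_ofReal]
        gcongr
        exact enorm_fourier_le h η
    _ = (∫⁻ η, ‖κ u η‖ₑ) * ∫⁻ y, ‖h y‖ₑ := lintegral_mul_const _ (by fun_prop)
    _ ≤ _ := by
        gcongr
        exact hκ.row u hu

/-- The `L¹` endpoint. The row bound squared against the weight leaves `u ^ (δ / 2)`, whose integral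
over `(0, 1)` is at most `2`. -/
lemma KernelBound.lintegral_le_of_integrable {κ : ℝ → ℝ → ℝ} {δ : ℝ} {B : ℝ≥0} (hδ : -1 < δ) (hκ : KernelBound κ δ B) (h : ℝ → ℂ) :
    ∫⁻ u in Set.Ioo (0 : ℝ) 1, ‖fourierKernelOp κ h u‖ₑ ^ (2 : ℝ) * ENNReal.ofReal (u ^ (-δ / 2)) ≤
      2 * B ^ 2 * (∫⁻ y, ‖h y‖ₑ) ^ 2 := by
  calc ∫⁻ u in Set.Ioo (0 : ℝ) 1,
        ‖fourierKernelOp κ h u‖ₑ ^ (2 : ℝ) * ENNReal.ofReal (u ^ (-δ / 2))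
      ≤ ∫⁻ u in Set.Ioo (0 : ℝ) 1,
        (B ^ 2 * (∫⁻ y, ‖h y‖ₑ) ^ 2) * ENNReal.ofReal (u ^ (δ / 2)) := by
        refine setLIntegral_mono' measurableSet_Ioo fun u hu => ?_
        have hpow : ENNReal.ofReal (u ^ (δ / 2)) =
            ENNReal.ofReal (u ^ (δ / 2)) ^ 2 * ENNReal.ofReal (u ^ (-δ / 2)) := by
          have := hu.1
          rw [← ENNReal.ofReal_pow (by positivity), ← ENNReal.ofReal_mul (by positivity),
            ← Real.rpow_natCast, ← Real.rpow_mul this.le, ← Real.rpow_add this]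
          congr 2
          push_cast
          ring
        rw [hpow, ← mul_assoc]
        gcongr
        rw [ENNReal.rpow_two]
        calc _ ≤ (B * ENNReal.ofReal (u ^ (δ / 2)) * ∫⁻ y, ‖h y‖ₑ) ^ 2 := by
              gcongr
              exact hκ.enorm_le h hu
          _ = _ := by ring
    _ = (B ^ 2 * (∫⁻ y, ‖h y‖ₑ) ^ 2) * ENNReal.ofReal (1 / (δ / 2 + 1)) := by
        rw [lintegral_const_mul _ (by fun_prop), lintegral_Ioo_rpow (by linarith) zero_le_one,
          Real.one_rpow]
    _ ≤ (B ^ 2 * (∫⁻ y, ‖h y‖ₑ) ^ 2) * 2 := by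
        gcongr
        rw [ENNReal.ofReal_le_ofNat, div_le_iff₀ (by linarith)]
        linarith
    _ = _ := by ring

/-- The `L²` endpoint, by Schur's test: Cauchy–Schwarz with respect to `|κ u η| dη` produces a row
integral that cancels the weight, the column bound handles the `u`-integral, and Plancherel
concludes. -/
lemma KernelBound.lintegral_le_of_memLp_two {κ : ℝ → ℝ → ℝ} {δ : ℝ} {B : ℝ≥0}
    (hκ : KernelBound κ δ B) {h : ℝ → ℂ} (h1 : Integrable h) (h2 : MemLp h 2) :
    ∫⁻ u in Set.Ioo (0 : ℝ) 1, ‖fourierKernelOp κ h u‖ₑ ^ (2 : ℝ) * ENNReal.ofReal (u ^ (-δ / 2)) ≤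
      B ^ 2 * ∫⁻ y, ‖h y‖ₑ ^ (2 : ℝ) := by
  have hF := (continuous_fourier h1).measurable
  have hpt : ∀ u ∈ Set.Ioo (0 : ℝ) 1,
      ‖fourierKernelOp κ h u‖ₑ ^ (2 : ℝ) * ENNReal.ofReal (u ^ (-δ / 2)) ≤
      B * ∫⁻ η, ‖κ u η‖ₑ * ‖𝓕 h η‖ₑ ^ (2 : ℝ) := by
    intro u hu
    have hm : Measurable (κ u) := hκ.measurable.comp measurable_prodMk_left
    have hcs : ‖fourierKernelOp κ h u‖ₑ ≤ (∫⁻ η, ‖κ u η‖ₑ) ^ (1 / 2 : ℝ) *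
        (∫⁻ η, ‖κ u η‖ₑ * ‖𝓕 h η‖ₑ ^ (2 : ℝ)) ^ (1 / 2 : ℝ) := by
      refine (enorm_integral_le_lintegral_enorm _).trans ?_
      refine le_trans (le_of_eq ?_) (ENNReal.lintegral_mul_norm_pow_le (by fun_prop) (by fun_prop)
        (by norm_num) (by norm_num) (by norm_num))
      congr 1 with η
      rw [enorm_mul, enorm_ofReal, ENNReal.mul_rpow_of_nonneg _ _ (by norm_num), ← mul_assoc,
        ← ENNReal.rpow_add_of_nonneg _ _ (by norm_num) (by norm_num), ← ENNReal.rpow_mul]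
      norm_num
    calc _ ≤ ((∫⁻ η, ‖κ u η‖ₑ) ^ (1 / 2 : ℝ) *
        (∫⁻ η, ‖κ u η‖ₑ * ‖𝓕 h η‖ₑ ^ (2 : ℝ)) ^ (1 / 2 : ℝ)) ^ (2 : ℝ) *
          ENNReal.ofReal (u ^ (-δ / 2)) := by gcongr
      _ = (∫⁻ η, ‖κ u η‖ₑ) * (∫⁻ η, ‖κ u η‖ₑ * ‖𝓕 h η‖ₑ ^ (2 : ℝ)) *
          ENNReal.ofReal (u ^ (-δ / 2)) := by
          rw [ENNReal.mul_rpow_of_nonneg _ _ (by norm_num), ← ENNReal.rpow_mul, ← ENNReal.rpow_mul]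
          norm_num
      _ ≤ (B * ENNReal.ofReal (u ^ (δ / 2))) * (∫⁻ η, ‖κ u η‖ₑ * ‖𝓕 h η‖ₑ ^ (2 : ℝ)) *
          ENNReal.ofReal (u ^ (-δ / 2)) := by
          gcongr
          exact hκ.row u hu
      _ = B * (∫⁻ η, ‖κ u η‖ₑ * ‖𝓕 h η‖ₑ ^ (2 : ℝ)) *
          (ENNReal.ofReal (u ^ (δ / 2)) * ENNReal.ofReal (u ^ (-δ / 2))) := by ring
      _ = _ := by
          have := hu.1
          rw [← ENNReal.ofReal_mul (by positivity), ← Real.rpow_add this]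
          norm_num [neg_div]
  have hmm : Measurable (Function.uncurry fun u η : ℝ => ‖κ u η‖ₑ * ‖𝓕 h η‖ₑ ^ (2 : ℝ)) :=
    hκ.measurable.enorm.mul ((hF.comp measurable_snd).enorm.pow_const _)
  calc _ ≤ ∫⁻ u in Set.Ioo (0 : ℝ) 1, B * ∫⁻ η, ‖κ u η‖ₑ * ‖𝓕 h η‖ₑ ^ (2 : ℝ) :=
        setLIntegral_mono' measurableSet_Ioo hpt
    _ = B * ∫⁻ η, (∫⁻ u in Set.Ioo (0 : ℝ) 1, ‖κ u η‖ₑ) * ‖𝓕 h η‖ₑ ^ (2 : ℝ) := by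
        rw [lintegral_const_mul' _ _ ENNReal.coe_ne_top, lintegral_lintegral_swap hmm.aemeasurable]
        congr 2 with η
        have hm : Measurable fun u => κ u η := hκ.measurable.comp measurable_prodMk_right
        rw [lintegral_mul_const _ (by fun_prop)]
    _ ≤ B * ∫⁻ η, B * ‖𝓕 h η‖ₑ ^ (2 : ℝ) := by
        gcongr with η
        exact hκ.col η
    _ = _ := by
        rw [lintegral_const_mul' _ _ ENNReal.coe_ne_top, lintegral_enorm_fourier_sq h1 h2]
        ring

/-- Hölder with exponents `3/4` and `1/4`. The dual weight is `u ^ (3 * δ / 2)`, integrable near `0`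
for the given `δ`. -/
lemma exists_eLpNorm_le_of_weighted {δ : ℝ} (hδ : -(1 / 2) < δ) :
    ∃ C : ℝ≥0, ∀ F : ℝ → ℂ, AEStronglyMeasurable F (volume.restrict (Set.Ioo (0 : ℝ) 1)) →
      eLpNorm F (3 / 2) (volume.restrict (Set.Ioo (0 : ℝ) 1)) ≤
      C * (∫⁻ u in Set.Ioo (0 : ℝ) 1, ‖F u‖ₑ ^ (2 : ℝ) * ENNReal.ofReal (u ^ (-δ / 2))) ^
        (1 / 2 : ℝ) := by
  refine ⟨((1 / (3 * δ / 2 + 1)).toNNReal) ^ (1 / 6 : ℝ), fun F hF => ?_⟩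
  have e32 : (3 / 2 : ℝ≥0∞).toReal = 3 / 2 := by simp
  rw [eLpNorm_eq_lintegral_rpow_enorm_toReal (by simp)
    (ENNReal.div_ne_top (by norm_num) (by norm_num)), e32]
  have hH : ∫⁻ u in Set.Ioo (0 : ℝ) 1, ‖F u‖ₑ ^ (3 / 2 : ℝ) ≤
      (∫⁻ u in Set.Ioo (0 : ℝ) 1, ‖F u‖ₑ ^ (2 : ℝ) * ENNReal.ofReal (u ^ (-δ / 2))) ^ (3 / 4 : ℝ) *
      (∫⁻ u in Set.Ioo (0 : ℝ) 1, ENNReal.ofReal (u ^ (3 * δ / 2))) ^ (1 / 4 : ℝ) := by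
    refine le_trans ?_ (ENNReal.lintegral_mul_norm_pow_le
      ((hF.enorm.pow_const _).mul (by fun_prop)) (by fun_prop)
      (by norm_num) (by norm_num) (by norm_num))
    refine setLIntegral_mono' measurableSet_Ioo fun u hu => le_of_eq ?_
    have := hu.1
    simp only [Pi.mul_apply]
    rw [ENNReal.mul_rpow_of_nonneg _ _ (by norm_num), ← ENNReal.rpow_mul,
      ENNReal.ofReal_rpow_of_nonneg (by positivity) (by norm_num),
      ENNReal.ofReal_rpow_of_nonneg (by positivity) (by norm_num), mul_assoc,
      ← ENNReal.ofReal_mul (by positivity), ← Real.rpow_mul this.le, ← Real.rpow_mul this.le,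
      ← Real.rpow_add this]
    rw [show -δ / 2 * (3 / 4) + 3 * δ / 2 * (1 / 4) = 0 by ring]
    norm_num
  rw [lintegral_Ioo_rpow (by linarith) zero_le_one, Real.one_rpow] at hH
  calc _ ≤ (_ : ℝ≥0∞) ^ (1 / (3 / 2) : ℝ) := ENNReal.rpow_le_rpow hH (by norm_num)
    _ = _ := by
      rw [ENNReal.mul_rpow_of_nonneg _ _ (by norm_num), ← ENNReal.rpow_mul, ← ENNReal.rpow_mul,
        mul_comm, ENNReal.coe_rpow_of_nonneg _ (by norm_num)]
      norm_num [ENNReal.ofReal]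

lemma KernelBound.fourierKernelOp_add {κ : ℝ → ℝ → ℝ} {δ : ℝ} {B : ℝ≥0} (hκ : KernelBound κ δ B)
    {h g : ℝ → ℂ} (hh : Integrable h) (hg : Integrable g) {u : ℝ} (hu : u ∈ Set.Ioo (0 : ℝ) 1) :
    fourierKernelOp κ (h + g) u = fourierKernelOp κ h u + fourierKernelOp κ g u := by
  have hadd : 𝓕 (h + g) = 𝓕 h + 𝓕 g :=
    VectorFourier.fourierIntegral_add (L := innerₗ ℝ) Real.continuous_fourierChar
      continuous_inner hh hg
  unfold fourierKernelOp
  rw [← integral_add (hκ.integrable hh hu) (hκ.integrable hg hu), hadd]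
  simp only [Pi.add_apply, mul_add]

/-- Both endpoints land in the same space, so real interpolation reduces to one splitting of `h` at
the height of its own `L^s` norm `N`: the low part has `L²` norm at most `N`, the high part has `L¹`
norm at most `N`. -/
lemma exists_eLpNorm_fourierKernelOp_le {δ : ℝ} (hδ : -(1 / 2) < δ) {s : ℝ} (hs : 1 ≤ s)
    (hs2 : s ≤ 2) : ∃ C : ℝ≥0, ∀ (κ : ℝ → ℝ → ℝ) (B : ℝ≥0), KernelBound κ δ B →
      ∀ h : ℝ → ℂ, Integrable h → ∫⁻ y, ‖h y‖ₑ ^ s ≠ ⊤ →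
        eLpNorm (fourierKernelOp κ h) (3 / 2) (volume.restrict (Set.Ioo (0 : ℝ) 1)) ≤
          C * B * (∫⁻ y, ‖h y‖ₑ ^ s) ^ (1 / s) := by
  obtain ⟨C, hC⟩ := exists_eLpNorm_le_of_weighted hδ
  refine ⟨3 * C, fun κ B hκ h h1 hfin => ?_⟩
  have hs0 : 0 < s := by linarith
  set N := (∫⁻ y, ‖h y‖ₑ ^ s) ^ (1 / s) with hN
  have hNs : ∫⁻ y, ‖h y‖ₑ ^ s = N ^ s := by
    rw [hN, ← ENNReal.rpow_mul, one_div_mul_cancel hs0.ne', ENNReal.rpow_one]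
  have hNtop : N ≠ ⊤ := ENNReal.rpow_ne_top_of_nonneg (by positivity) hfin
  -- The power `N ^ (1 - s)` used for the high part needs `N ≠ 0`.
  rcases eq_or_ne N 0 with hN0 | hN0
  · rw [hN0, ENNReal.zero_rpow_of_pos hs0, lintegral_eq_zero_iff'
      (h1.aestronglyMeasurable.enorm.pow_const s)] at hNs
    have h0 : ∫⁻ y, ‖h y‖ₑ = 0 := by
      rw [lintegral_eq_zero_iff' h1.aestronglyMeasurable.enorm]
      filter_upwards [hNs] with y hy
      simpa [hs0.ne', hs0, hs0.not_gt] using hy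
    rw [hN0, mul_zero, nonpos_iff_eq_zero]
    refine (eLpNorm_congr_ae (g := fun _ => (0 : ℂ)) ?_).trans eLpNorm_zero'
    filter_upwards [ae_restrict_mem measurableSet_Ioo] with u hu
    have := hκ.enorm_le h hu
    rw [h0, mul_zero, nonpos_iff_eq_zero, enorm_eq_zero] at this
    exact this
  -- split `h` at height `N` into a bounded and an integrable part
  obtain ⟨h', hh'm, hh'⟩ := h1.aestronglyMeasurable
  have h1' : Integrable h' := h1.congr hh'
  have hNs' : ∫⁻ y, ‖h' y‖ₑ ^ s = N ^ s := by
    rw [← hNs]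
    exact lintegral_congr_ae (by filter_upwards [hh'] with y hy; rw [hy])
  have hTeq : fourierKernelOp κ h = fourierKernelOp κ h' := by
    have : 𝓕 h = 𝓕 h' := by
      ext ξ
      rw [Real.fourier_eq, Real.fourier_eq]
      exact integral_congr_ae (by filter_upwards [hh'] with y hy; rw [hy])
    unfold fourierKernelOp
    rw [this]
  set S := {y | ‖h' y‖ₑ ≤ N} with hS
  have hSm : MeasurableSet S := measurableSet_le hh'm.enorm measurable_const
  set a := S.indicator h' with ha
  set b := Sᶜ.indicator h' with hb
  have hab : h' = a + b := (Set.indicator_self_add_compl S h').symm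
  have ha1 : Integrable a := h1'.indicator hSm
  have hb1 : Integrable b := h1'.indicator hSm.compl
  have ha2 : ∫⁻ y, ‖a y‖ₑ ^ (2 : ℝ) ≤ N ^ 2 := by
    calc ∫⁻ y, ‖a y‖ₑ ^ (2 : ℝ) ≤ ∫⁻ y, N ^ (2 - s) * ‖h' y‖ₑ ^ s := by
          refine lintegral_mono fun y => ?_
          by_cases hy : y ∈ S
          · rw [ha, Set.indicator_of_mem hy]
            calc ‖h' y‖ₑ ^ (2 : ℝ) = ‖h' y‖ₑ ^ (2 - s) * ‖h' y‖ₑ ^ s := by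
                  rw [← ENNReal.rpow_add_of_nonneg _ _ (by linarith) hs0.le, sub_add_cancel]
              _ ≤ _ := by
                  gcongr ?_ * _
                  exact ENNReal.rpow_le_rpow hy (by linarith)
          · rw [ha, Set.indicator_of_notMem hy]
            simp
      _ = N ^ (2 - s) * N ^ s := by
          rw [lintegral_const_mul' _ _ (ENNReal.rpow_ne_top_of_nonneg (by linarith) hNtop), hNs']
      _ = N ^ 2 := by
          rw [← ENNReal.rpow_add_of_nonneg _ _ (by linarith) hs0.le, sub_add_cancel,
            ENNReal.rpow_two]
  have hb2 : ∫⁻ y, ‖b y‖ₑ ≤ N := by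
    calc ∫⁻ y, ‖b y‖ₑ ≤ ∫⁻ y, N ^ (1 - s) * ‖h' y‖ₑ ^ s := by
          refine lintegral_mono fun y => ?_
          by_cases hy : y ∈ Sᶜ
          · rw [hb, Set.indicator_of_mem hy]
            have hlt : N < ‖h' y‖ₑ := not_le.1 hy
            calc ‖h' y‖ₑ = ‖h' y‖ₑ ^ (1 - s) * ‖h' y‖ₑ ^ s := by
                  rw [← ENNReal.rpow_add _ _ (pos_of_gt hlt).ne' enorm_ne_top, sub_add_cancel,
                    ENNReal.rpow_one]
              _ ≤ _ := by
                  gcongr ?_ * _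
                  rw [← neg_sub s 1, ENNReal.rpow_neg, ENNReal.rpow_neg, ENNReal.inv_le_inv]
                  exact ENNReal.rpow_le_rpow hlt.le (by linarith)
          · rw [hb, Set.indicator_of_notMem hy]
            simp
      _ = N ^ (1 - s) * N ^ s := by
          rw [lintegral_const_mul' _ _ (ENNReal.rpow_ne_top_of_ne_zero hN0 hNtop), hNs']
      _ = N := by
          rw [← ENNReal.rpow_add _ _ hN0 hNtop, sub_add_cancel, ENNReal.rpow_one]
  have ha2' : MemLp a 2 := by
    refine ⟨ha1.aestronglyMeasurable, ?_⟩
    rw [eLpNorm_lt_top_iff_lintegral_rpow_enorm_lt_top (by norm_num) (by norm_num)]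
    simpa using ha2.trans_lt (ENNReal.pow_lt_top hNtop.lt_top)
  have hBN : ∀ x : ℝ≥0∞, (x ^ 2) ^ (1 / 2 : ℝ) = x := fun x => by
    rw [← ENNReal.rpow_two, ← ENNReal.rpow_mul]
    norm_num
  rw [hTeq]
  calc eLpNorm (fourierKernelOp κ h') (3 / 2) (volume.restrict (Set.Ioo (0 : ℝ) 1))
      = eLpNorm (fourierKernelOp κ a + fourierKernelOp κ b) (3 / 2)
          (volume.restrict (Set.Ioo (0 : ℝ) 1)) := by
        refine eLpNorm_congr_ae ?_
        filter_upwards [ae_restrict_mem measurableSet_Ioo] with u hu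
        conv_lhs => rw [hab]
        exact hκ.fourierKernelOp_add ha1 hb1 hu
    _ ≤ eLpNorm (fourierKernelOp κ a) (3 / 2) (volume.restrict (Set.Ioo (0 : ℝ) 1)) +
          eLpNorm (fourierKernelOp κ b) (3 / 2) (volume.restrict (Set.Ioo (0 : ℝ) 1)) := by
        refine eLpNorm_add_le (aestronglyMeasurable_fourierKernelOp hκ.measurable ha1)
          (aestronglyMeasurable_fourierKernelOp hκ.measurable hb1) ?_
        rw [ENNReal.le_div_iff_mul_le (by simp) (by simp)]
        norm_num
    _ ≤ C * (B ^ 2 * N ^ 2) ^ (1 / 2 : ℝ) + C * (2 * B ^ 2 * N ^ 2) ^ (1 / 2 : ℝ) := by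
        refine add_le_add ?_ ?_
        · refine (hC _ (aestronglyMeasurable_fourierKernelOp hκ.measurable ha1)).trans ?_
          gcongr
          exact (hκ.lintegral_le_of_memLp_two ha1 ha2').trans (by gcongr)
        · refine (hC _ (aestronglyMeasurable_fourierKernelOp hκ.measurable hb1)).trans ?_
          gcongr
          exact (hκ.lintegral_le_of_integrable (by linarith) b).trans (by gcongr)
    _ ≤ C * ((B * N) ^ 2) ^ (1 / 2 : ℝ) + C * ((2 * B * N) ^ 2) ^ (1 / 2 : ℝ) := by
        gcongr
        · rw [mul_pow]
        · rw [mul_pow, mul_pow]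
          gcongr
          norm_num
    _ = _ := by
        rw [hBN, hBN]
        push_cast
        ring

/-! ### Row, column and translation estimates for `(u - η²)₊ ^ δ`. -/

lemma lintegral_Iio_posPow {a c : ℝ} (ha : -1 < a) (hc : 0 ≤ c) :
    ∫⁻ x in Set.Iio c, ENNReal.ofReal (posPow a x) = ENNReal.ofReal (c ^ (a + 1) / (a + 1)) := by
  rw [← lintegral_Ioo_rpow ha hc, ← lintegral_indicator measurableSet_Iio,
    ← lintegral_indicator measurableSet_Ioo]
  congr 1 with x
  by_cases h0 : 0 < x
  · by_cases h1 : x < c <;> simp [Set.indicator, h0, h1, posPow_of_pos]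
  · simp [Set.indicator, h0, posPow_of_nonpos (not_lt.1 h0)]

lemma setLIntegral_Iio_comp_sub (f : ℝ → ℝ≥0∞) (c v : ℝ) :
    ∫⁻ x in Set.Iio c, f (x - v) = ∫⁻ x in Set.Iio (c - v), f x := by
  rw [← lintegral_indicator measurableSet_Iio, ← lintegral_indicator measurableSet_Iio,
    ← lintegral_sub_right_eq_self ((Set.Iio (c - v)).indicator f) v]
  congr 1 with x
  simp [Set.indicator]

lemma setLIntegral_Ici_comp_sub_left (f : ℝ → ℝ≥0∞) (c v : ℝ) :
    ∫⁻ x in Set.Ici c, f (v - x) = ∫⁻ x in Set.Iic (v - c), f x := by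
  rw [← lintegral_indicator measurableSet_Ici, ← lintegral_indicator measurableSet_Iic,
    ← lintegral_sub_left_eq_self ((Set.Iic (v - c)).indicator f) v]
  congr 1 with x
  simp only [Set.indicator, Set.mem_Ici, Set.mem_Iic, sub_le_sub_iff_left]

/-- Translation estimate for a function that increases up to the set `E`. -/
lemma lintegral_enorm_comp_add_sub_le {ψ : ℝ → ℝ} (hψ : ∀ x, 0 ≤ ψ x) (hm : Measurable ψ)
    (hfin : ∫⁻ x, ENNReal.ofReal (ψ x) ≠ ⊤) {E : Set ℝ} (hE : MeasurableSet E) {τ : ℝ}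
    (hmono : ∀ x ∉ E, ψ x ≤ ψ (x + τ)) :
    ∫⁻ x, ‖ψ (x + τ) - ψ x‖ₑ ≤ 2 * ∫⁻ x in E, ENNReal.ofReal (ψ x) := by
  -- Off `E` the increment is nonnegative and this is an equality; on `E` the extra `2 ψ` pays for a
  -- possible decrease. After integration the masses of `ψ` and of its translate cancel, being equal
  -- and finite.
  have hpt : ∀ x, ‖ψ (x + τ) - ψ x‖ₑ + ENNReal.ofReal (ψ x) ≤
      ENNReal.ofReal (ψ (x + τ)) + 2 * E.indicator (fun x => ENNReal.ofReal (ψ x)) x := by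
    intro x
    rw [Real.enorm_eq_ofReal_abs, ← ENNReal.ofReal_add (abs_nonneg _) (hψ _)]
    by_cases hx : x ∈ E
    · rw [Set.indicator_of_mem hx, show (2 : ℝ≥0∞) = ENNReal.ofReal 2 by norm_num,
        ← ENNReal.ofReal_mul (by norm_num),
        ← ENNReal.ofReal_add (hψ _) (by linarith [hψ x])]
      refine ENNReal.ofReal_le_ofReal ?_
      rcases abs_cases (ψ (x + τ) - ψ x) with h | h <;> linarith [hψ x, hψ (x + τ)]
    · rw [Set.indicator_of_notMem hx, mul_zero, add_zero,
        abs_of_nonneg (sub_nonneg.2 (hmono x hx)), sub_add_cancel]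
  have hint := lintegral_mono hpt (μ := volume)
  rw [lintegral_add_right _ (by fun_prop), lintegral_add_left (by fun_prop),
    lintegral_const_mul' _ _ (by norm_num), lintegral_indicator hE,
    lintegral_add_right_eq_self (fun x => ENNReal.ofReal (ψ x)) τ, add_comm] at hint
  exact (ENNReal.add_le_add_iff_left hfin).1 hint

/-- The kernel `(u - η²)₊ ^ δ` of the linear Bochner–Riesz means. -/
noncomputable def rieszKernel (δ u η : ℝ) : ℝ := posPow δ (u - η ^ 2)

lemma measurable_rieszKernel (δ : ℝ) : Measurable (Function.uncurry (rieszKernel δ)) :=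
  (measurable_posPow δ).comp (by fun_prop)

/-- Factor `u - η² = (√u + η)(√u - η)`; since `δ ≤ 0`, the first factor is largest when replaced by
`√u`. -/
lemma rieszKernel_le {δ : ℝ} (hδ : δ ≤ 0) {u η : ℝ} (hu : 0 < u) (hη : 0 < η) :
    rieszKernel δ u η ≤ u ^ (δ / 2) * posPow δ (√u - η) := by
  have ht : 0 < √u := Real.sqrt_pos.2 hu
  have hfac : u - η ^ 2 = (√u + η) * (√u - η) := by
    rw [← sq_sub_sq, Real.sq_sqrt hu.le]
  rw [rieszKernel, hfac, posPow_mul (by positivity)]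
  gcongr
  · exact posPow_nonneg _ _
  · rw [show u ^ (δ / 2) = √u ^ δ by
      rw [Real.sqrt_eq_rpow, ← Real.rpow_mul hu.le]; ring_nf]
    exact Real.rpow_le_rpow_of_nonpos ht (by linarith) hδ

lemma lintegral_halfKernel_le {δ : ℝ} (hδ : -1 < δ) (hδ0 : δ ≤ 0) {u : ℝ} (hu : 0 < u) {τ : ℝ}
    (hτ : 0 < τ) :
    ∫⁻ η in Set.Ici (√u - τ), ENNReal.ofReal ((Set.Ioi 0).indicator (rieszKernel δ u) η) ≤
      ENNReal.ofReal (τ ^ (δ + 1) / (δ + 1)) * ENNReal.ofReal (u ^ (δ / 2)) := by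
  calc _ ≤ ∫⁻ η in Set.Ici (√u - τ),
        ENNReal.ofReal (u ^ (δ / 2)) * ENNReal.ofReal (posPow δ (√u - η)) := by
        refine lintegral_mono fun η => ?_
        by_cases hη : 0 < η
        · rw [Set.indicator_of_mem (by exact hη), ← ENNReal.ofReal_mul (by positivity)]
          exact ENNReal.ofReal_le_ofReal (rieszKernel_le hδ0 hu hη)
        · rw [Set.indicator_of_notMem (by exact hη)]
          simp
    _ = _ := by
        rw [lintegral_const_mul' _ _ ENNReal.ofReal_ne_top, setLIntegral_Ici_comp_sub_left
          (fun x => ENNReal.ofReal (posPow δ x)), sub_sub_cancel,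
          setLIntegral_congr Iio_ae_eq_Iic.symm, lintegral_Iio_posPow hδ hτ.le, mul_comm]

lemma lintegral_halfKernel_univ_le {δ : ℝ} (hδ : -1 < δ) (hδ0 : δ ≤ 0) {u : ℝ} (hu : 0 < u) :
    ∫⁻ η, ENNReal.ofReal ((Set.Ioi 0).indicator (rieszKernel δ u) η) ≤
      ENNReal.ofReal ((√u + 1) ^ (δ + 1) / (δ + 1)) * ENNReal.ofReal (u ^ (δ / 2)) := by
  -- With `τ = √u + 1` the half-line starts at `-1` and so contains the support.
  refine le_trans ?_ (lintegral_halfKernel_le hδ hδ0 hu (τ := √u + 1) (by positivity))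
  rw [← lintegral_indicator measurableSet_Ici]
  refine lintegral_mono fun η => ?_
  by_cases hη : 0 < η
  · rw [Set.indicator_of_mem (show η ∈ Set.Ici (√u - (√u + 1)) by simp; linarith)]
  · simp [Set.indicator, hη]

/-- The even kernel is split because each half increases monotonically up to its singularity at
`±√u`, as the translation estimate requires. -/
lemma rieszKernel_eq_halfKernel_add (δ u : ℝ) {η : ℝ} (hη : η ≠ 0) :
    rieszKernel δ u η = (Set.Ioi 0).indicator (rieszKernel δ u) η +
      (Set.Ioi 0).indicator (rieszKernel δ u) (-η) := by
  rcases lt_or_gt_of_ne hη with h | h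
  · simp [Set.indicator, h, h.not_gt, rieszKernel]
  · simp [Set.indicator, h, h.not_gt]

lemma measurable_halfKernel (δ u : ℝ) : Measurable ((Set.Ioi 0).indicator (rieszKernel δ u)) :=
  ((measurable_rieszKernel δ).comp measurable_prodMk_left).indicator measurableSet_Ioi

lemma halfKernel_nonneg (δ u η : ℝ) : 0 ≤ (Set.Ioi 0).indicator (rieszKernel δ u) η :=
  Set.indicator_nonneg (fun _ _ => posPow_nonneg _ _) _

lemma lintegral_halfKernel_sub_le {δ : ℝ} (hδ : -1 < δ) (hδ0 : δ ≤ 0) {u : ℝ} (hu : 0 < u) {τ : ℝ}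
    (hτ : 0 < τ) :
    ∫⁻ η, ‖(Set.Ioi 0).indicator (rieszKernel δ u) (η + τ) -
      (Set.Ioi 0).indicator (rieszKernel δ u) η‖ₑ ≤
      2 * (ENNReal.ofReal (τ ^ (δ + 1) / (δ + 1)) * ENNReal.ofReal (u ^ (δ / 2))) := by
  refine (lintegral_enorm_comp_add_sub_le (halfKernel_nonneg δ u) (measurable_halfKernel δ u)
    ((lintegral_halfKernel_univ_le hδ hδ0 hu).trans_lt
      (ENNReal.mul_lt_top ENNReal.ofReal_lt_top ENNReal.ofReal_lt_top)).ne
    (E := Set.Ici (√u - τ)) measurableSet_Ici fun x hx => ?_).trans ?_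
  · rw [Set.mem_Ici, not_le] at hx
    rcases le_or_gt x 0 with h0 | h0
    · rw [Set.indicator_of_notMem (by simpa using h0)]
      exact halfKernel_nonneg _ _ _
    · rw [Set.indicator_of_mem (by exact h0),
        Set.indicator_of_mem (show x + τ ∈ Set.Ioi 0 by simp; linarith), rieszKernel, rieszKernel]
      have hpos : 0 < u - (x + τ) ^ 2 := by
        have : (x + τ) ^ 2 < √u ^ 2 := by gcongr; linarith
        rw [Real.sq_sqrt hu.le] at this
        linarith
      have hlt : u - (x + τ) ^ 2 ≤ u - x ^ 2 := by
        have : x ^ 2 ≤ (x + τ) ^ 2 := by gcongr; linarith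
        linarith
      rw [posPow_of_pos hpos, posPow_of_pos (hpos.trans_le hlt)]
      exact Real.rpow_le_rpow_of_nonpos hpos hlt hδ0
  · gcongr
    exact lintegral_halfKernel_le hδ hδ0 hu hτ

lemma lintegral_rieszKernel_sub_le {δ : ℝ} (hδ : -1 < δ) (hδ0 : δ ≤ 0) {u : ℝ} (hu : 0 < u)
    {τ : ℝ} (hτ : 0 < τ) :
    ∫⁻ η, ‖rieszKernel δ u (η + τ) - rieszKernel δ u η‖ₑ ≤
      4 * (ENNReal.ofReal (τ ^ (δ + 1) / (δ + 1)) * ENNReal.ofReal (u ^ (δ / 2))) := by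
  set ψ := (Set.Ioi 0).indicator (rieszKernel δ u) with hψ
  have hψm : Measurable ψ := measurable_halfKernel δ u
  have hmain := lintegral_halfKernel_sub_le hδ hδ0 hu hτ
  have hrefl : ∫⁻ η, ‖ψ (-(η + τ)) - ψ (-η)‖ₑ = ∫⁻ η, ‖ψ (η + τ) - ψ η‖ₑ := by
    rw [← lintegral_sub_left_eq_self (fun η => ‖ψ (η + τ) - ψ η‖ₑ) (-τ)]
    congr 1 with η
    rw [show -(η + τ) = -τ - η by ring, show -τ - η + τ = -η by ring, ← enorm_neg, neg_sub]
  calc _ ≤ ∫⁻ η, (‖ψ (η + τ) - ψ η‖ₑ + ‖ψ (-(η + τ)) - ψ (-η)‖ₑ) := by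
        refine lintegral_mono_ae ?_
        filter_upwards [compl_mem_ae_iff.2 (measure_singleton (0 : ℝ)),
          compl_mem_ae_iff.2 (measure_singleton (-τ))] with η h0 h1
        have h1' : η + τ ≠ 0 := fun h => h1 (by simp; linarith)
        rw [rieszKernel_eq_halfKernel_add δ u h1', rieszKernel_eq_halfKernel_add δ u h0, add_sub_add_comm]
        exact enorm_add_le _ _
    _ = (∫⁻ η, ‖ψ (η + τ) - ψ η‖ₑ) + ∫⁻ η, ‖ψ (-(η + τ)) - ψ (-η)‖ₑ :=
        lintegral_add_left (by fun_prop) _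
    _ ≤ _ := by
        rw [hrefl]
        calc _ ≤ 2 * (ENNReal.ofReal (τ ^ (δ + 1) / (δ + 1)) * ENNReal.ofReal (u ^ (δ / 2))) +
            2 * (ENNReal.ofReal (τ ^ (δ + 1) / (δ + 1)) * ENNReal.ofReal (u ^ (δ / 2))) :=
              add_le_add hmain hmain
          _ = _ := by ring

/-- The same cancellation as for translations in `η`: moving the singularity from `v` to `w`
increases the function beyond `w`, and on `(0, 1)` the later translate has no more mass than the
earlier one. -/
lemma lintegral_posPow_sub_sub_le {δ : ℝ} (hδ : -1 < δ) (hδ0 : δ ≤ 0) {v w : ℝ} (hv : 0 ≤ v)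
    (hvw : v ≤ w) :
    ∫⁻ u in Set.Ioo (0 : ℝ) 1, ‖posPow δ (u - w) - posPow δ (u - v)‖ₑ ≤
      2 * ENNReal.ofReal ((w - v) ^ (δ + 1) / (δ + 1)) := by
  have hm := measurable_posPow δ
  have hw : 0 ≤ w := hv.trans hvw
  have hIoo : ∀ x : ℝ, 0 ≤ x → ∫⁻ u in Set.Ioo (0 : ℝ) 1, ENNReal.ofReal (posPow δ (u - x)) =
      ∫⁻ u in Set.Iio (1 - x), ENNReal.ofReal (posPow δ u) := by
    intro x hx
    rw [← setLIntegral_Iio_comp_sub (fun u => ENNReal.ofReal (posPow δ u)),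
      ← lintegral_indicator measurableSet_Iio, ← lintegral_indicator measurableSet_Ioo]
    congr 1 with u
    by_cases hu : 0 < u
    · simp [Set.indicator, hu]
    · simp [Set.indicator, hu, posPow_of_nonpos (show u - x ≤ 0 by linarith)]
  have hpt : ∀ u, ‖posPow δ (u - w) - posPow δ (u - v)‖ₑ + ENNReal.ofReal (posPow δ (u - v)) ≤
      ENNReal.ofReal (posPow δ (u - w)) +
        2 * (Set.Iic w).indicator (fun u => ENNReal.ofReal (posPow δ (u - v))) u := by
    intro u
    rw [Real.enorm_eq_ofReal_abs]
    by_cases hu : u ≤ w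
    · rw [Set.indicator_of_mem (by exact hu), posPow_of_nonpos (sub_nonpos.2 hu), zero_sub, abs_neg,
        abs_of_nonneg (posPow_nonneg _ _), ENNReal.ofReal_zero, zero_add, two_mul]
    · have hu' : 0 < u - w := sub_pos.2 (not_le.1 hu)
      have hle : posPow δ (u - v) ≤ posPow δ (u - w) := by
        rw [posPow_of_pos hu', posPow_of_pos (show 0 < u - v by linarith)]
        exact Real.rpow_le_rpow_of_nonpos hu' (by linarith) hδ0
      rw [Set.indicator_of_notMem (by exact hu), mul_zero, add_zero,
        abs_of_nonneg (sub_nonneg.2 hle),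
        ← ENNReal.ofReal_add (sub_nonneg.2 hle) (posPow_nonneg _ _), sub_add_cancel]
  have hint := lintegral_mono hpt (μ := volume.restrict (Set.Ioo (0 : ℝ) 1))
  rw [lintegral_add_right _ (by fun_prop), lintegral_add_left (by fun_prop),
    lintegral_const_mul' _ _ (by norm_num), hIoo v hv, hIoo w hw] at hint
  have htail : ∫⁻ u in Set.Ioo (0 : ℝ) 1,
      (Set.Iic w).indicator (fun u => ENNReal.ofReal (posPow δ (u - v))) u ≤
      ENNReal.ofReal ((w - v) ^ (δ + 1) / (δ + 1)) := by
    calc _ ≤ ∫⁻ u, (Set.Iic w).indicator (fun u => ENNReal.ofReal (posPow δ (u - v))) u :=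
          setLIntegral_le_lintegral _ _
      _ = _ := by
          rw [lintegral_indicator measurableSet_Iic, setLIntegral_congr Iio_ae_eq_Iic.symm,
            setLIntegral_Iio_comp_sub (fun u => ENNReal.ofReal (posPow δ u)),
            lintegral_Iio_posPow hδ (sub_nonneg.2 hvw)]
  have hfin : ∫⁻ u in Set.Iio (1 - v), ENNReal.ofReal (posPow δ u) ≠ ⊤ := by
    refine ((lintegral_mono_set (Set.Iio_subset_Iio (show 1 - v ≤ 1 by linarith))).trans_lt ?_).ne
    rw [lintegral_Iio_posPow hδ zero_le_one]
    exact ENNReal.ofReal_lt_top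
  have hmono : ∫⁻ u in Set.Iio (1 - w), ENNReal.ofReal (posPow δ u) ≤
      ∫⁻ u in Set.Iio (1 - v), ENNReal.ofReal (posPow δ u) :=
    lintegral_mono_set (Set.Iio_subset_Iio (by linarith))
  have := hint.trans (add_le_add_left hmono _)
  rw [add_comm] at this
  exact ((ENNReal.add_le_add_iff_left hfin).1 this).trans (by gcongr)

lemma lintegral_posPow_sub_le {δ : ℝ} (hδ : -1 < δ) {v : ℝ} (hv : 0 ≤ v) :
    ∫⁻ u in Set.Ioo (0 : ℝ) 1, ENNReal.ofReal (posPow δ (u - v)) ≤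
      ENNReal.ofReal (1 / (δ + 1)) := by
  calc _ ≤ ∫⁻ u in Set.Iio (1 : ℝ), ENNReal.ofReal (posPow δ (u - v)) :=
        lintegral_mono_set fun u hu => hu.2
    _ = ∫⁻ u in Set.Iio (1 - v), ENNReal.ofReal (posPow δ u) :=
        setLIntegral_Iio_comp_sub (fun u => ENNReal.ofReal (posPow δ u)) _ _
    _ ≤ ∫⁻ u in Set.Iio (1 : ℝ), ENNReal.ofReal (posPow δ u) :=
        lintegral_mono_set (Set.Iio_subset_Iio (by linarith))
    _ = _ := by rw [lintegral_Iio_posPow hδ zero_le_one, Real.one_rpow]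

lemma kernelBound_rieszKernel {δ : ℝ} (hδ : -1 < δ) (hδ0 : δ ≤ 0) :
    KernelBound (rieszKernel δ) δ (6 / (δ + 1)).toNNReal where
  measurable := measurable_rieszKernel δ
  row u hu := by
    set ψ := (Set.Ioi 0).indicator (rieszKernel δ u) with hψ
    have hψm : Measurable ψ := measurable_halfKernel δ u
    have hψ0 := halfKernel_nonneg δ u
    have hrefl : ∫⁻ η, ENNReal.ofReal (ψ (-η)) = ∫⁻ η, ENNReal.ofReal (ψ η) := by
      rw [← lintegral_sub_left_eq_self (fun η => ENNReal.ofReal (ψ η)) 0]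
      simp
    have hb := lintegral_halfKernel_univ_le hδ hδ0 hu.1
    calc _ ≤ ∫⁻ η, (ENNReal.ofReal (ψ η) + ENNReal.ofReal (ψ (-η))) := by
          refine lintegral_mono_ae ?_
          filter_upwards [compl_mem_ae_iff.2 (measure_singleton (0 : ℝ))] with η h0
          rw [rieszKernel_eq_halfKernel_add δ u h0, ← ENNReal.ofReal_add (hψ0 _) (hψ0 _),
            Real.enorm_eq_ofReal (add_nonneg (hψ0 _) (hψ0 _))]
      _ = 2 * ∫⁻ η, ENNReal.ofReal (ψ η) := by
          rw [lintegral_add_left (by fun_prop), hrefl, two_mul]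
      _ ≤ 2 * (ENNReal.ofReal ((√u + 1) ^ (δ + 1) / (δ + 1)) * ENNReal.ofReal (u ^ (δ / 2))) := by
          gcongr
      _ ≤ _ := by
          rw [← mul_assoc]
          gcongr
          rw [show (2 : ℝ≥0∞) = ENNReal.ofReal 2 by norm_num, ← ENNReal.ofReal_mul (by norm_num)]
          refine ENNReal.ofReal_le_ofReal ?_
          rw [← mul_div_assoc]
          have hs1 : √u ≤ 1 := Real.sqrt_le_one.2 hu.2.le
          have : (√u + 1) ^ (δ + 1) ≤ 2 := by
            calc (√u + 1) ^ (δ + 1) ≤ (√u + 1) ^ (1 : ℝ) :=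
                  Real.rpow_le_rpow_of_exponent_le (by linarith [Real.sqrt_nonneg u]) (by linarith)
              _ ≤ 2 := by rw [Real.rpow_one]; linarith
          have : 0 < δ + 1 := by linarith
          gcongr
          linarith
  col η := by
    calc _ = ∫⁻ u in Set.Ioo (0 : ℝ) 1, ENNReal.ofReal (posPow δ (u - η ^ 2)) := by
          simp_rw [rieszKernel, Real.enorm_eq_ofReal (posPow_nonneg _ _)]
      _ ≤ _ := (lintegral_posPow_sub_le hδ (sq_nonneg η)).trans (by
          have : 0 < δ + 1 := by linarith
          refine ENNReal.ofReal_le_ofReal ?_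
          gcongr
          norm_num)

/-- The gain `τ ^ (δ + 1)` is the mass of the kernel within distance about `τ` of its singularity.
-/
lemma kernelBound_rieszKernel_sub {δ : ℝ} (hδ : -1 < δ) (hδ0 : δ ≤ 0) {τ : ℝ} (hτ : 0 < τ)
    (hτ1 : τ ≤ 1) :
    KernelBound (fun u η => rieszKernel δ u (η + τ) - rieszKernel δ u η) δ
      (6 / (δ + 1) * τ ^ (δ + 1)).toNNReal where
  measurable := by
    have := measurable_rieszKernel δ
    exact (this.comp (f := fun z : ℝ × ℝ => (z.1, z.2 + τ)) (by fun_prop)).sub this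
  row u hu := by
    have h1 : 0 < δ + 1 := by linarith
    refine (lintegral_rieszKernel_sub_le hδ hδ0 hu.1 hτ).trans ?_
    rw [← mul_assoc]
    gcongr
    rw [show (4 : ℝ≥0∞) = ENNReal.ofReal 4 by norm_num, ← ENNReal.ofReal_mul (by norm_num)]
    refine ENNReal.ofReal_le_ofReal ?_
    rw [div_mul_eq_mul_div, ← mul_div_assoc]
    gcongr
    norm_num
  col η := by
    have h1 : 0 < δ + 1 := by linarith
    have hbase : ∀ v w : ℝ, 0 ≤ v → v ≤ w → w - v ≤ 3 * τ →
        ∫⁻ u in Set.Ioo (0 : ℝ) 1, ‖posPow δ (u - w) - posPow δ (u - v)‖ₑ ≤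
        ((6 / (δ + 1) * τ ^ (δ + 1)).toNNReal : ℝ≥0∞) := by
      intro v w hv hvw hd
      refine (lintegral_posPow_sub_sub_le hδ hδ0 hv hvw).trans ?_
      rw [show (2 : ℝ≥0∞) = ENNReal.ofReal 2 by norm_num, ← ENNReal.ofReal_mul (by norm_num)]
      refine ENNReal.ofReal_le_ofReal ?_
      have h3 : (w - v) ^ (δ + 1) ≤ 3 * τ ^ (δ + 1) := by
        calc (w - v) ^ (δ + 1) ≤ (3 * τ) ^ (δ + 1) :=
              Real.rpow_le_rpow (by linarith) hd h1.le
          _ = 3 ^ (δ + 1) * τ ^ (δ + 1) := Real.mul_rpow (by norm_num) hτ.le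
          _ ≤ 3 ^ (1 : ℝ) * τ ^ (δ + 1) := by gcongr <;> linarith
          _ = _ := by rw [Real.rpow_one]
      rw [div_mul_eq_mul_div, ← mul_div_assoc]
      exact div_le_div_of_nonneg_right (by linarith) h1.le
    simp only [rieszKernel]
    -- If either point lies in `(-1, 1)`, then `|2 η + τ| ≤ 3` and the squares differ by at most `3
    -- τ`. Otherwise both kernels vanish, as `u < 1`.
    by_cases hsmall : |η| < 1 ∨ |η + τ| < 1
    · have hd : |(η + τ) ^ 2 - η ^ 2| ≤ 3 * τ := by
        rw [show (η + τ) ^ 2 - η ^ 2 = (2 * η + τ) * τ by ring, abs_mul, abs_of_pos hτ]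
        gcongr
        rw [abs_le]
        rcases hsmall with h | h <;> rw [abs_lt] at h <;> constructor <;> linarith
      rcases le_total (η ^ 2) ((η + τ) ^ 2) with h | h
      · exact hbase _ _ (sq_nonneg _) h ((le_abs_self _).trans hd)
      · simp_rw [← enorm_neg (posPow δ (_ - (η + τ) ^ 2) - _), neg_sub]
        exact hbase _ _ (sq_nonneg _) h ((neg_sub ((η + τ) ^ 2) _ ▸ neg_le_abs _).trans hd)
    · rw [not_or, not_lt, not_lt] at hsmall
      refine le_trans (le_of_eq ?_) zero_le
      rw [setLIntegral_congr_fun measurableSet_Ioo (g := fun _ => 0), lintegral_zero]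
      intro u hu
      have e1 : 1 ≤ η ^ 2 := (one_le_sq_iff_one_le_abs _).2 hsmall.1
      have e2 : 1 ≤ (η + τ) ^ 2 := (one_le_sq_iff_one_le_abs _).2 hsmall.2
      simp only
      rw [posPow_of_nonpos (by linarith [hu.2]), posPow_of_nonpos (by linarith [hu.2])]
      simp

/-! ### Modulation, dyadic annuli and the linear estimate. -/

lemma one_le_norm_fourierChar_sub_one {x : ℝ} (h1 : 1 / 4 ≤ |x|) (h2 : |x| ≤ 1 / 2) :
    1 ≤ ‖(Real.fourierChar x : ℂ) - 1‖ := by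
  have hcos : Real.cos (2 * Real.pi * x) ≤ 0 := by
    rw [← Real.cos_abs, abs_mul, abs_of_pos Real.two_pi_pos]
    have := Real.pi_pos
    exact Real.cos_nonpos_of_pi_div_two_le_of_le (by nlinarith) (by nlinarith)
  have hre : ((Real.fourierChar x : ℂ) - 1).re = Real.cos (2 * Real.pi * x) - 1 := by
    rw [Real.fourierChar_apply, Complex.sub_re, Complex.one_re, Complex.exp_ofReal_mul_I_re]
  calc (1 : ℝ) ≤ |((Real.fourierChar x : ℂ) - 1).re| := by
        rw [hre, abs_of_nonpos (by linarith)]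
        linarith
    _ ≤ _ := Complex.abs_re_le_norm _

lemma fourier_modulation_sub {h : ℝ → ℂ} (hh : Integrable h) (τ η : ℝ) :
    𝓕 (fun y => ((Real.fourierChar (y * τ) : ℂ) - 1) * h y) η = 𝓕 h (η - τ) - 𝓕 h η := by
  have hi : ∀ w : ℝ, Integrable fun y : ℝ => (Real.fourierChar (-(inner ℝ y w)) : Circle) • h y :=
    fun w => (VectorFourier.fourierIntegral_convergent_iff (L := innerₗ ℝ)
      Real.continuous_fourierChar continuous_inner w).2 hh
  rw [Real.fourier_eq, Real.fourier_eq, Real.fourier_eq, ← integral_sub (hi _) (hi _)]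
  congr 1 with y
  simp only [Circle.smul_def, smul_eq_mul, RCLike.inner_apply, conj_trivial]
  rw [show -((η - τ) * y) = -(η * y) + y * τ by ring, AddChar.map_add_eq_mul, Circle.coe_mul]
  ring

/-- Multiplication by a character translates the Fourier transform, and a change of variables moves
that translation onto the kernel. -/
lemma fourierKernelOp_modulation {κ : ℝ → ℝ → ℝ} {δ τ : ℝ} {B B' : ℝ≥0} (hκ : KernelBound κ δ B)
    (hκτ : KernelBound (fun u η => κ u (η + τ) - κ u η) δ B') {h : ℝ → ℂ} (hh : Integrable h)
    {u : ℝ} (hu : u ∈ Set.Ioo (0 : ℝ) 1) :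
    fourierKernelOp κ (fun y => ((Real.fourierChar (y * τ) : ℂ) - 1) * h y) u =
      fourierKernelOp (fun u η => κ u (η + τ) - κ u η) h u := by
  have i1 := hκ.integrable hh hu
  have i2 := hκτ.integrable hh hu
  have i3 : Integrable fun η => (κ u (η + τ) : ℂ) * 𝓕 h η := by
    refine (i2.add i1).congr (Filter.Eventually.of_forall fun η => ?_)
    simp only [Pi.add_apply]
    push_cast
    ring
  have i4 : Integrable fun η => (κ u η : ℂ) * 𝓕 h (η - τ) := by
    refine (i3.comp_sub_right τ).congr (Filter.Eventually.of_forall fun η => ?_)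
    simp
  unfold fourierKernelOp
  calc ∫ η, (κ u η : ℂ) * 𝓕 (fun y => ((Real.fourierChar (y * τ) : ℂ) - 1) * h y) η
      = ∫ η, ((κ u η : ℂ) * 𝓕 h (η - τ) - (κ u η : ℂ) * 𝓕 h η) := by
        congr 1 with η
        rw [fourier_modulation_sub hh, mul_sub]
    _ = (∫ η, (κ u (η + τ) : ℂ) * 𝓕 h η) - ∫ η, (κ u η : ℂ) * 𝓕 h η := by
        rw [integral_sub i4 i1,
          ← integral_sub_right_eq_self (fun η => (κ u (η + τ) : ℂ) * 𝓕 h η) τ]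
        simp
    _ = _ := by
        rw [← integral_sub i3 i1]
        congr 1 with η
        push_cast
        ring

/-- On the annulus `e^{2πiyτ} - 1` has modulus at least `1`, so dividing `g` by it does not increase
`|g|`; the operator then carries the difference kernel with its small bound. -/
lemma exists_eLpNorm_rieszKernel_annulus_le {δ : ℝ} (hδ : -(1 / 2) < δ) (hδ0 : δ ≤ 0) {s : ℝ}
    (hs : 1 ≤ s) (hs2 : s ≤ 2) : ∃ C : ℝ≥0, ∀ τ : ℝ, 0 < τ → τ ≤ 1 → ∀ g : ℝ → ℂ, Integrable g →
      (∀ y, g y ≠ 0 → 1 / 4 ≤ |y * τ| ∧ |y * τ| ≤ 1 / 2) → ∫⁻ y, ‖g y‖ₑ ^ s ≠ ⊤ →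
      eLpNorm (fourierKernelOp (rieszKernel δ) g) (3 / 2)
        (volume.restrict (Set.Ioo (0 : ℝ) 1)) ≤
        C * ENNReal.ofReal (τ ^ (δ + 1)) * (∫⁻ y, ‖g y‖ₑ ^ s) ^ (1 / s) := by
  obtain ⟨C, hC⟩ := exists_eLpNorm_fourierKernelOp_le hδ hs hs2
  refine ⟨C * (6 / (δ + 1)).toNNReal, fun τ hτ hτ1 g hg hsupp hfin => ?_⟩
  have hδ1 : 0 < δ + 1 := by linarith
  set h : ℝ → ℂ := fun y => ((Real.fourierChar (y * τ) : ℂ) - 1)⁻¹ * g y with hh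
  have hle : ∀ y, ‖h y‖ₑ ≤ ‖g y‖ₑ := by
    intro y
    by_cases hy : g y = 0
    · simp [hh, hy]
    · obtain ⟨h1, h2⟩ := hsupp y hy
      rw [enorm_le_iff_norm_le, hh, norm_mul, norm_inv]
      have := one_le_norm_fourierChar_sub_one h1 h2
      calc _ ≤ 1 * ‖g y‖ := by gcongr; exact inv_le_one_of_one_le₀ this
        _ = _ := one_mul _
  have hcont : Continuous fun y : ℝ => (Real.fourierChar (y * τ) : ℂ) - 1 := by
    have := Real.continuous_fourierChar
    fun_prop
  have hhi : Integrable h := by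
    refine hg.mono ?_ (Filter.Eventually.of_forall fun y => ?_)
    · exact hcont.measurable.inv.aestronglyMeasurable.mul hg.1
    · exact enorm_le_iff_norm_le.1 (hle y)
  have hgh : g = fun y => ((Real.fourierChar (y * τ) : ℂ) - 1) * h y := by
    ext y
    by_cases hy : g y = 0
    · simp [hh, hy]
    · obtain ⟨h1, h2⟩ := hsupp y hy
      have hne : (Real.fourierChar (y * τ) : ℂ) - 1 ≠ 0 :=
        norm_pos_iff.1 (zero_lt_one.trans_le (one_le_norm_fourierChar_sub_one h1 h2))
      simp only [hh]
      rw [mul_inv_cancel_left₀ hne]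
  have hint : ∫⁻ y, ‖h y‖ₑ ^ s ≤ ∫⁻ y, ‖g y‖ₑ ^ s :=
    lintegral_mono fun y => ENNReal.rpow_le_rpow (hle y) (by linarith)
  have hk := kernelBound_rieszKernel_sub (by linarith : -1 < δ) hδ0 hτ hτ1
  calc _ = eLpNorm (fourierKernelOp (fun u η => rieszKernel δ u (η + τ) - rieszKernel δ u η) h)
          (3 / 2) (volume.restrict (Set.Ioo (0 : ℝ) 1)) := by
        refine eLpNorm_congr_ae ?_
        filter_upwards [ae_restrict_mem measurableSet_Ioo] with u hu
        conv_lhs => rw [hgh]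
        exact fourierKernelOp_modulation (kernelBound_rieszKernel (by linarith) hδ0) hk hhi hu
    _ ≤ _ := hC _ _ hk h hhi (ne_top_of_le_ne_top hfin hint)
    _ ≤ _ := by
        rw [Real.toNNReal_mul (by positivity), ENNReal.coe_mul, ENNReal.coe_mul, ENNReal.ofReal,
          ← mul_assoc]
        gcongr

/-- Qualitative: the `L¹` tails tend to zero, and for fixed `u` the operator is bounded from `L¹`.
It feeds Fatou's lemma for the dyadic sum. -/
lemma tendsto_fourierKernelOp_ball {κ : ℝ → ℝ → ℝ} {δ : ℝ} {B : ℝ≥0} (hκ : KernelBound κ δ B)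
    {g : ℝ → ℂ} (hg : Integrable g) {u : ℝ} (hu : u ∈ Set.Ioo (0 : ℝ) 1) :
    Filter.Tendsto (fun n : ℕ => fourierKernelOp κ ((Metric.ball (0 : ℝ) (2 ^ n)).indicator g) u)
      Filter.atTop (nhds (fourierKernelOp κ g u)) := by
  have hb : ∀ n : ℕ, MeasurableSet (Metric.ball (0 : ℝ) (2 ^ n)) := fun n => measurableSet_ball
  have htail : Filter.Tendsto (fun n : ℕ => ∫⁻ y, ‖(Metric.ball (0 : ℝ) (2 ^ n))ᶜ.indicator g y‖ₑ)
      Filter.atTop (nhds (∫⁻ _ : ℝ, 0)) := by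
    refine tendsto_lintegral_of_dominated_convergence' (fun y => ‖g y‖ₑ)
      (fun n => (hg.1.indicator (hb n).compl).enorm) (fun n => Filter.Eventually.of_forall fun y => ?_)
      hg.2.ne (Filter.Eventually.of_forall fun y => ?_)
    · exact enorm_indicator_le_enorm_self _ _
    · refine tendsto_const_nhds.congr' ?_
      have : Filter.Tendsto (fun n : ℕ => (2 : ℝ) ^ n) Filter.atTop Filter.atTop :=
        tendsto_pow_atTop_atTop_of_one_lt (by norm_num)
      filter_upwards [this.eventually_gt_atTop |y|] with n hn
      rw [Set.indicator_of_notMem (by simpa using hn), enorm_zero]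
  rw [lintegral_zero] at htail
  rw [tendsto_iff_edist_tendsto_0]
  have hlim := ENNReal.Tendsto.const_mul (a := B * ENNReal.ofReal (u ^ (δ / 2))) htail
    (Or.inr (ENNReal.mul_ne_top ENNReal.coe_ne_top ENNReal.ofReal_ne_top))
  rw [mul_zero] at hlim
  refine tendsto_of_tendsto_of_tendsto_of_le_of_le tendsto_const_nhds hlim (fun _ => zero_le)
    fun n => ?_
  have hsplit := hκ.fourierKernelOp_add (hg.indicator (hb n)) (hg.indicator (hb n).compl) hu
  rw [Set.indicator_self_add_compl] at hsplit
  simp only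
  rw [hsplit, edist_comm, edist_eq_enorm_sub, add_sub_cancel_left]
  exact hκ.enorm_le _ hu

/-- The local square-function type bound for the linear Bochner–Riesz means in terms of averages
of `‖g‖ ^ s`. -/
theorem exists_eLpNorm_rieszKernel_le {δ : ℝ} (hδ : -(1 / 2) < δ) (hδ0 : δ ≤ 0) {s : ℝ}
    (hs : 1 ≤ s) (hs2 : s ≤ 2) (hsδ : 1 / s < 1 + δ) : ∃ C : ℝ≥0, ∀ g : ℝ → ℂ, Integrable g →
      ∀ A : ℝ≥0∞, A ≠ ⊤ →
      (∀ r : ℝ, 0 < r → ∫⁻ y in Metric.closedBall 0 r, ‖g y‖ₑ ^ s ≤ ENNReal.ofReal r * A) →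
      eLpNorm (fourierKernelOp (rieszKernel δ) g) (3 / 2)
        (volume.restrict (Set.Ioo (0 : ℝ) 1)) ≤ C * A ^ (1 / s) := by
  obtain ⟨C₁, hC₁⟩ := exists_eLpNorm_fourierKernelOp_le hδ hs hs2
  obtain ⟨C₂, hC₂⟩ := exists_eLpNorm_rieszKernel_annulus_le hδ hδ0 hs hs2
  have hs0 : 0 < s := by linarith
  have hk := kernelBound_rieszKernel (by linarith : -1 < δ) hδ0
  set K : ℝ≥0 := C₁ * (6 / (δ + 1)).toNNReal + C₂ with hK
  -- Ratio of the dyadic series: each doubling of the radius costs `2 ^ (1 / s)` in the `L^s` norm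
  -- and gains `2 ^ (-(1 + δ))` from the annulus.
  set ρ : ℝ≥0 := 2 ^ (1 / s - (1 + δ)) with hρ
  have hρ1 : (ρ : ℝ≥0∞) < 1 := by
    rw [← ENNReal.coe_one, ENNReal.coe_lt_coe]
    exact NNReal.rpow_lt_one_of_one_lt_of_neg (by norm_num) (by linarith)
  refine ⟨K * (1 - ρ)⁻¹, fun g hg A hA hgA => ?_⟩
  set G : ℕ → ℝ → ℂ := fun n => (Metric.ball (0 : ℝ) (2 ^ n)).indicator g with hG
  have hb : ∀ n : ℕ, MeasurableSet (Metric.ball (0 : ℝ) (2 ^ n)) := fun n => measurableSet_ball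
  have hGi : ∀ n, Integrable (G n) := fun n => hg.indicator (hb n)
  have hN : ∀ n : ℕ, ∀ f : ℝ → ℂ, (∀ y, ‖f y‖ₑ ≤ ‖G n y‖ₑ) → ∫⁻ y, ‖f y‖ₑ ^ s ≤
      ENNReal.ofReal (2 ^ n) * A := by
    intro n f hf
    refine le_trans ?_ (hgA (2 ^ n) (by positivity))
    rw [← lintegral_indicator measurableSet_closedBall]
    refine lintegral_mono fun y => ?_
    by_cases hy : y ∈ Metric.ball (0 : ℝ) (2 ^ n)
    · rw [Set.indicator_of_mem (Metric.ball_subset_closedBall hy)]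
      refine ENNReal.rpow_le_rpow ((hf y).trans ?_) hs0.le
      simp only [hG]
      rw [Set.indicator_of_mem hy]
    · have h0 := hf y
      simp only [hG] at h0
      rw [Set.indicator_of_notMem hy, enorm_zero, nonpos_iff_eq_zero] at h0
      simp [h0, hs0]
  have hfinA : ∀ n : ℕ, ENNReal.ofReal (2 ^ n) * A ≠ ⊤ :=
    fun n => ENNReal.mul_ne_top ENNReal.ofReal_ne_top hA
  have hsum : ∀ n : ℕ, eLpNorm (fourierKernelOp (rieszKernel δ) (G n)) (3 / 2)
      (volume.restrict (Set.Ioo (0 : ℝ) 1)) ≤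
      ∑ k ∈ Finset.range (n + 1), K * (ρ : ℝ≥0∞) ^ k * A ^ (1 / s) := by
    intro n
    induction n with
    | zero =>
      have h0 := hN 0 (G 0) fun _ => le_rfl
      rw [pow_zero, ENNReal.ofReal_one, one_mul] at h0
      simp only [zero_add, Finset.range_one, Finset.sum_singleton, pow_zero, mul_one]
      refine (hC₁ _ _ hk _ (hGi 0) (ne_top_of_le_ne_top hA h0)).trans ?_
      rw [← ENNReal.coe_mul]
      gcongr
      exact le_self_add
    | succ n ih =>
      set g' : ℝ → ℂ := (Metric.ball (0 : ℝ) (2 ^ n))ᶜ.indicator (G (n + 1)) with hg'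
      have hsplit : G (n + 1) = G n + g' := by
        rw [hg', ← Set.indicator_self_add_compl (Metric.ball (0 : ℝ) (2 ^ n)) (G (n + 1))]
        congr 1
        · simp only [hG]
          rw [Set.indicator_indicator, Set.inter_eq_left.2 (Metric.ball_subset_ball ?_)]
          exact pow_le_pow_right₀ (by norm_num) (Nat.le_succ n)
        · rw [Set.indicator_self_add_compl]
      have hg'i : Integrable g' := (hGi _).indicator (hb n).compl
      have hg'N := hN (n + 1) g' fun y => enorm_indicator_le_enorm_self _ _
      -- For `2 ^ n ≤ |y| < 2 ^ (n + 1)` this `τ` places `|y τ|` between `1/4` and `1/2`.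
      have hpiece := hC₂ ((2 : ℝ) ^ (-(n + 2 : ℝ))) (by positivity)
        (Real.rpow_le_one_of_one_le_of_nonpos (by norm_num) (by linarith [n.cast_nonneg (α := ℝ)]))
        g' hg'i ?_ (ne_top_of_le_ne_top (hfinA _) hg'N)
      swap
      · intro y hy
        have h1 : y ∈ (Metric.ball (0 : ℝ) (2 ^ n))ᶜ := Set.mem_of_indicator_ne_zero hy
        rw [hg', Set.indicator_of_mem h1] at hy
        have h2 : y ∈ Metric.ball (0 : ℝ) (2 ^ (n + 1)) := Set.mem_of_indicator_ne_zero hy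
        simp only [Set.mem_compl_iff, Metric.mem_ball, dist_zero_right, Real.norm_eq_abs, not_lt] at h1 h2
        have hτ : (2 : ℝ) ^ (-(n + 2 : ℝ)) = (2 ^ n * 4)⁻¹ := by
          rw [Real.rpow_neg (by norm_num)]
          norm_cast
          rw [pow_add]
          norm_num
        rw [abs_mul, hτ, abs_of_pos (a := ((2 : ℝ) ^ n * 4)⁻¹) (by positivity), ← div_eq_mul_inv,
          le_div_iff₀ (by positivity), div_le_iff₀ (by positivity)]
        rw [pow_succ] at h2
        constructor <;> linarith
      rw [Finset.sum_range_succ]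
      calc _ = eLpNorm (fourierKernelOp (rieszKernel δ) (G n) + fourierKernelOp (rieszKernel δ) g')
            (3 / 2) (volume.restrict (Set.Ioo (0 : ℝ) 1)) := by
            refine eLpNorm_congr_ae ?_
            filter_upwards [ae_restrict_mem measurableSet_Ioo] with u hu
            rw [hsplit]
            exact hk.fourierKernelOp_add (hGi n) hg'i hu
        _ ≤ _ := eLpNorm_add_le (aestronglyMeasurable_fourierKernelOp hk.measurable (hGi n))
            (aestronglyMeasurable_fourierKernelOp hk.measurable hg'i) (by
              rw [ENNReal.le_div_iff_mul_le (by simp) (by simp)]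
              norm_num)
        _ ≤ _ := by
            refine add_le_add ih (hpiece.trans ?_)
            calc _ ≤ C₂ * ENNReal.ofReal (((2 : ℝ) ^ (-(n + 2 : ℝ))) ^ (δ + 1)) *
                  (ENNReal.ofReal (2 ^ (n + 1)) * A) ^ (1 / s) := by gcongr
              _ = C₂ * ENNReal.ofReal (((2 : ℝ) ^ (-(n + 2 : ℝ))) ^ (δ + 1) *
                  ((2 : ℝ) ^ (n + 1)) ^ (1 / s)) * A ^ (1 / s) := by
                  rw [ENNReal.mul_rpow_of_nonneg _ _ (by positivity),
                    ENNReal.ofReal_rpow_of_nonneg (by positivity) (by positivity),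
                    ENNReal.ofReal_mul (by positivity)]
                  ring
              _ ≤ _ := by
                  gcongr ?_ * ?_ * _
                  · rw [hK]
                    exact_mod_cast le_add_self
                  · rw [← ENNReal.coe_pow, ENNReal.ofReal, ENNReal.coe_le_coe, Real.toNNReal_le_iff_le_coe]
                    rw [hρ, NNReal.coe_pow, NNReal.coe_rpow, ← Real.rpow_natCast, ← Real.rpow_natCast,
                      NNReal.coe_ofNat, ← Real.rpow_mul (by norm_num), ← Real.rpow_mul (by norm_num),
                      ← Real.rpow_mul (by norm_num), ← Real.rpow_add (by norm_num)]
                    refine Real.rpow_le_rpow_of_exponent_le (by norm_num) ?_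
                    push_cast
                    nlinarith
  refine (Lp.eLpNorm_lim_le_liminf_eLpNorm
    (f := fun n => fourierKernelOp (rieszKernel δ) (G n))
    (fun n => aestronglyMeasurable_fourierKernelOp hk.measurable (hGi n)) _ ?_).trans ?_
  · filter_upwards [ae_restrict_mem measurableSet_Ioo] with u hu
    exact tendsto_fourierKernelOp_ball hk hg hu
  · refine Filter.liminf_le_of_le (by isBoundedDefault) fun b hbev => ?_
    obtain ⟨n, hn⟩ := hbev.exists
    refine (hn.trans (hsum n)).trans ?_
    rw [← Finset.sum_mul, ← Finset.mul_sum]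
    push_cast
    rw [ENNReal.coe_inv (tsub_pos_of_lt (by exact_mod_cast hρ1)).ne', ENNReal.coe_sub,
      ENNReal.coe_one, ← ENNReal.tsum_geometric]
    gcongr
    exact ENNReal.sum_le_tsum _

/-! ### The Young inequality on the simplex. -/

lemma lintegral_fin_succ {m : ℕ} (i : Fin (m + 1)) {F : (Fin (m + 1) → ℝ) → ℝ≥0∞}
    (hF : Measurable F) : ∫⁻ s, F s = ∫⁻ y : Fin m → ℝ, ∫⁻ x : ℝ, F (i.insertNth x y) := by
  have hmp := (volume_preserving_piFinSuccAbove (fun _ : Fin (m + 1) => ℝ) i).symm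
  rw [← hmp.lintegral_comp_emb (MeasurableEquiv.measurableEmbedding _), Measure.volume_eq_prod,
    lintegral_prod_symm]
  · rfl
  · exact (hF.comp (MeasurableEquiv.measurable _)).aemeasurable

lemma lintegral_fin_prod_eq_prod (m : ℕ) : ∀ f : Fin m → ℝ → ℝ≥0∞, (∀ i, Measurable (f i)) →
    ∫⁻ y : Fin m → ℝ, ∏ i, f i (y i) = ∏ i, ∫⁻ x, f i x := by
  induction m with
  | zero => intro f _; simp [volume_pi]
  | succ m ih =>
    intro f hf
    have hm : Measurable fun y : Fin (m + 1) → ℝ => ∏ i, f i (y i) :=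
      Finset.measurable_prod _ fun i _ => (hf i).comp (measurable_pi_apply i)
    rw [lintegral_fin_succ 0 hm, Fin.prod_univ_succ, ← ih (fun i => f i.succ) fun i => hf _, ← lintegral_const_mul]
    · congr 1 with y
      simp only [Fin.insertNth_zero, Fin.prod_univ_succ, Fin.cons_zero, Fin.cons_succ]
      rw [lintegral_mul_const _ (hf 0)]
      rfl
    · exact Finset.measurable_prod _ fun i _ => (hf _).comp (measurable_pi_apply i)

/-- The variable `s i` occurs only in `w`, so integrating it first gives the full integral of `w` by
translation and reflection; the rest factors. -/
lemma lintegral_comp_sum_mul_prod {m : ℕ} (i : Fin (m + 1)) {w : ℝ → ℝ≥0∞} (hw : Measurable w)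
    {f : Fin (m + 1) → ℝ → ℝ≥0∞} (hf : ∀ i, Measurable (f i)) (c : ℝ) :
    ∫⁻ s : Fin (m + 1) → ℝ, w (c - ∑ j, s j) * ∏ j : Fin m, f (i.succAbove j) (s (i.succAbove j)) =
      (∫⁻ x, w x) * ∏ j : Fin m, ∫⁻ x, f (i.succAbove j) x := by
  rw [lintegral_fin_succ i, ← lintegral_fin_prod_eq_prod m (fun j => f (i.succAbove j))
    fun j => hf _, ← lintegral_const_mul]
  · congr 1 with y
    simp only [Fin.sum_univ_succAbove _ i, Fin.insertNth_apply_same, Fin.insertNth_apply_succAbove]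
    rw [lintegral_mul_const _ (by fun_prop)]
    congr 1
    rw [← lintegral_sub_left_eq_self w (c - ∑ j, y j)]
    congr 1 with x
    ring_nf
  · exact Finset.measurable_prod _ fun i _ => (hf _).comp (measurable_pi_apply i)
  · refine Measurable.mul (hw.comp (by fun_prop))
      (Finset.measurable_prod _ fun j _ => (hf _).comp (measurable_pi_apply _))

/-- A trilinear Young inequality on the simplex. -/
lemma lintegral_simplex_le {γ : ℝ} (hγ : -1 < γ) {F : Fin 3 → ℝ → ℝ≥0∞}
    (hF : ∀ i, Measurable (F i)) (hF0 : ∀ i, ∀ x ≤ 0, F i x = 0) :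
    ∫⁻ s : Fin 3 → ℝ, ENNReal.ofReal (posPow γ (1 - ∑ i, s i)) * ∏ i, F i (s i) ≤
      ENNReal.ofReal (1 / (γ + 1)) *
        ∏ i, (∫⁻ x in Set.Ioo (0 : ℝ) 1, F i x ^ (3 / 2 : ℝ)) ^ (2 / 3 : ℝ) := by
  -- On the support all `s i` are positive, so the argument of the weight is below `1`; cutting
  -- there makes the weight integrable over `ℝ`.
  set w : ℝ → ℝ≥0∞ := (Set.Iio 1).indicator fun x => ENNReal.ofReal (posPow γ x) with hw
  have hwm : Measurable w := (measurable_posPow γ).ennreal_ofReal.indicator measurableSet_Iio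
  have hwint : ∫⁻ x, w x = ENNReal.ofReal (1 / (γ + 1)) := by
    rw [hw, lintegral_indicator measurableSet_Iio, lintegral_Iio_posPow hγ zero_le_one,
      Real.one_rpow]
  set H : Fin 3 → ℝ → ℝ≥0∞ := fun i => (Set.Ioo (0 : ℝ) 1).indicator fun x => F i x ^ (3 / 2 : ℝ)
    with hH
  have hHm : ∀ i, Measurable (H i) := fun i => ((hF i).pow_const _).indicator measurableSet_Ioo
  have hHint : ∀ i, ∫⁻ x, H i x = ∫⁻ x in Set.Ioo (0 : ℝ) 1, F i x ^ (3 / 2 : ℝ) :=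
    fun i => lintegral_indicator measurableSet_Ioo _
  -- Hölder with three exponents `1/3`: `w` occurs in every `Φ i`, and each `H j = F j ^ (3/2)` in
  -- exactly two of them, so the product of the cube roots restores the integrand.
  set Φ : Fin 3 → (Fin 3 → ℝ) → ℝ≥0∞ := fun i s =>
    w (1 - ∑ j, s j) * ∏ j : Fin 2, H (i.succAbove j) (s (i.succAbove j)) with hΦ
  have hΦm : ∀ i, Measurable (Φ i) := fun i => Measurable.mul (hwm.comp (by fun_prop))
      (Finset.measurable_prod _ fun j _ => (hHm _).comp (measurable_pi_apply _))
  have hpow3 : ∀ a b c d : ℝ≥0∞, (a * (b ^ (3 / 2 : ℝ) * c ^ (3 / 2 : ℝ))) ^ (1 / 3 : ℝ) *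
      (a * (d ^ (3 / 2 : ℝ) * c ^ (3 / 2 : ℝ))) ^ (1 / 3 : ℝ) *
      (a * (d ^ (3 / 2 : ℝ) * b ^ (3 / 2 : ℝ))) ^ (1 / 3 : ℝ) = a * (d * b * c) := by
    intro a b c d
    simp only [ENNReal.mul_rpow_of_nonneg _ _ (by norm_num : (0 : ℝ) ≤ 1 / 3), ← ENNReal.rpow_mul]
    norm_num
    have h3 : ∀ x : ℝ≥0∞, x ^ (1 / 3 : ℝ) * x ^ (1 / 3 : ℝ) * x ^ (1 / 3 : ℝ) = x := fun x => by
      rw [← ENNReal.rpow_add_of_nonneg _ _ (by norm_num) (by norm_num),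
        ← ENNReal.rpow_add_of_nonneg _ _ (by norm_num) (by norm_num)]
      norm_num
    have h2 : ∀ x : ℝ≥0∞, x ^ (1 / 2 : ℝ) * x ^ (1 / 2 : ℝ) = x := fun x => by
      rw [← ENNReal.rpow_add_of_nonneg _ _ (by norm_num) (by norm_num)]
      norm_num
    conv_rhs => rw [← h3 a, ← h2 b, ← h2 c, ← h2 d]
    ring
  have hpt : ∀ s : Fin 3 → ℝ, ENNReal.ofReal (posPow γ (1 - ∑ i, s i)) * ∏ i, F i (s i) ≤
      ∏ i, Φ i s ^ (1 / 3 : ℝ) := by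
    intro s
    by_cases hs : ∀ i, 0 < s i
    swap
    · push Not at hs
      obtain ⟨i, hi⟩ := hs
      rw [Finset.prod_eq_zero (Finset.mem_univ i) (hF0 i _ hi), mul_zero]
      exact zero_le
    by_cases hsum : ∑ i, s i < 1
    swap
    · rw [posPow_of_nonpos (by linarith)]
      simp
    have hmem : ∀ i, s i ∈ Set.Ioo (0 : ℝ) 1 := fun i =>
      ⟨hs i, (Finset.single_le_sum (fun j _ => (hs j).le) (Finset.mem_univ i)).trans_lt hsum⟩
    have hsumpos : 0 < ∑ i, s i := Finset.sum_pos (fun i _ => hs i) Finset.univ_nonempty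
    have hwe : w (1 - ∑ i, s i) = ENNReal.ofReal (posPow γ (1 - ∑ i, s i)) :=
      Set.indicator_of_mem (show 1 - ∑ i, s i ∈ Set.Iio 1 by simpa using hsumpos) _
    have hHe : ∀ i, H i (s i) = F i (s i) ^ (3 / 2 : ℝ) := fun i => Set.indicator_of_mem (hmem i) _
    simp only [hΦ, hwe, hHe, Fin.prod_univ_three, Fin.prod_univ_two]
    exact (hpow3 _ _ _ _).ge
  calc _ ≤ ∫⁻ s, ∏ i, Φ i s ^ (1 / 3 : ℝ) := lintegral_mono hpt
    _ ≤ ∏ i, (∫⁻ s, Φ i s) ^ (1 / 3 : ℝ) :=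
        ENNReal.lintegral_prod_norm_pow_le _ (fun i _ => (hΦm i).aemeasurable) (by simp)
          (fun _ _ => by norm_num)
    _ = _ := by
        have hI : ∀ i, ∫⁻ x in Set.Ioo (0 : ℝ) 1, F i x ^ (3 / 2 : ℝ) =
            ((∫⁻ x in Set.Ioo (0 : ℝ) 1, F i x ^ (3 / 2 : ℝ)) ^ (2 / 3 : ℝ)) ^ (3 / 2 : ℝ) := by
          intro i
          rw [← ENNReal.rpow_mul]
          norm_num
        have hΦint : ∀ i, ∫⁻ s, Φ i s = ENNReal.ofReal (1 / (γ + 1)) *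
            ∏ j : Fin 2, ∫⁻ x in Set.Ioo (0 : ℝ) 1, F (i.succAbove j) x ^ (3 / 2 : ℝ) := fun i =>
          (lintegral_comp_sum_mul_prod i hwm hHm 1).trans (by rw [hwint]; simp only [hHint])
        simp only [hΦint, Fin.prod_univ_three, Fin.prod_univ_two]
        rw [← hpow3, ← hI, ← hI, ← hI]
        rfl

/-! ### From the multilinear mean to linear operators. -/

lemma integral_prod_posPow {m : ℕ} {δ : Fin m → ℝ} {γ : ℝ} {C : ℝ≥0} {a : Fin m → ℝ} {b : ℝ}
    (h : ∫⁻ s : Fin m → ℝ, ENNReal.ofReal (posPow γ (b - ∑ i, s i)) *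
          ∏ i, ENNReal.ofReal (posPow (δ i) (s i - a i)) =
        C * ENNReal.ofReal (posPow (γ + ∑ i, (δ i + 1)) (b - ∑ i, a i))) :
    ∫ s : Fin m → ℝ, posPow γ (b - ∑ i, s i) * ∏ i, posPow (δ i) (s i - a i) =
      C * posPow (γ + ∑ i, (δ i + 1)) (b - ∑ i, a i) := by
  rw [integral_eq_lintegral_of_nonneg_ae]
  · have e : ∀ s : Fin m → ℝ, ENNReal.ofReal (posPow γ (b - ∑ i, s i) *
        ∏ i, posPow (δ i) (s i - a i)) = ENNReal.ofReal (posPow γ (b - ∑ i, s i)) *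
          ∏ i, ENNReal.ofReal (posPow (δ i) (s i - a i)) := fun s => by
      rw [ENNReal.ofReal_mul (posPow_nonneg _ _),
        ENNReal.ofReal_prod_of_nonneg fun i _ => posPow_nonneg _ _]
    simp_rw [e, h]
    rw [ENNReal.toReal_mul, ENNReal.toReal_ofReal (posPow_nonneg _ _), ENNReal.coe_toReal]
  · exact Filter.Eventually.of_forall fun s =>
      mul_nonneg (posPow_nonneg _ _) (Finset.prod_nonneg fun i _ => posPow_nonneg _ _)
  · refine (Measurable.mul ((measurable_posPow γ).comp (by fun_prop))
      (Finset.measurable_prod _ fun i _ =>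
        (measurable_posPow _).comp (by fun_prop))).aestronglyMeasurable

/-- The multilinear Bochner–Riesz multiplier operator as an average of products of linear ones. -/
lemma integral_posPow_mul_prod_eq {m : ℕ} {δ : Fin m → ℝ} {γ : ℝ} {C : ℝ≥0}
    (hC : ∀ (a : Fin m → ℝ) (b : ℝ), ∫⁻ s : Fin m → ℝ, ENNReal.ofReal (posPow γ (b - ∑ i, s i)) *
          ∏ i, ENNReal.ofReal (posPow (δ i) (s i - a i)) =
        C * ENNReal.ofReal (posPow (γ + ∑ i, (δ i + 1)) (b - ∑ i, a i)))
    (hα : 0 ≤ γ + ∑ i, (δ i + 1)) {H : Fin m → ℝ → ℂ} (hHm : ∀ i, Measurable (H i))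
    (hH : ∀ i, Integrable (H i)) :
    (C : ℂ) * ∫ ξ : Fin m → ℝ, (posPow (γ + ∑ i, (δ i + 1)) (1 - ∑ i, ξ i ^ 2) : ℂ) *
        ∏ i, H i (ξ i) =
      ∫ s : Fin m → ℝ, (posPow γ (1 - ∑ i, s i) : ℂ) *
        ∏ i, ∫ η, (rieszKernel (δ i) (s i) η : ℂ) * H i η := by
  have hpm := measurable_posPow
  have hmeas : Measurable (Function.uncurry fun (s ξ : Fin m → ℝ) =>
      (posPow γ (1 - ∑ i, s i) : ℂ) * ∏ i, ((rieszKernel (δ i) (s i) (ξ i) : ℂ) * H i (ξ i))) := by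
    refine Measurable.mul ?_ (Finset.measurable_prod _ fun i _ => Measurable.mul ?_ ?_)
    · exact Complex.measurable_ofReal.comp ((hpm γ).comp (by fun_prop))
    · exact Complex.measurable_ofReal.comp ((hpm _).comp (by fun_prop))
    · exact (hHm i).comp (by fun_prop)
  have hinner : ∀ ξ : Fin m → ℝ, ∫⁻ s : Fin m → ℝ, ‖(posPow γ (1 - ∑ i, s i) : ℂ) *
      ∏ i, ((rieszKernel (δ i) (s i) (ξ i) : ℂ) * H i (ξ i))‖ₑ =
      C * ENNReal.ofReal (posPow (γ + ∑ i, (δ i + 1)) (1 - ∑ i, ξ i ^ 2)) * ‖∏ i, H i (ξ i)‖ₑ := by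
    intro ξ
    rw [← hC, ← lintegral_mul_const' _ _ enorm_ne_top]
    congr 1 with s
    rw [Finset.prod_mul_distrib, ← mul_assoc, enorm_mul]
    congr 1
    simp only [rieszKernel]
    rw [← Complex.ofReal_prod, ← Complex.ofReal_mul, enorm_ofReal, Real.enorm_eq_ofReal
      (mul_nonneg (posPow_nonneg _ _) (Finset.prod_nonneg fun i _ => posPow_nonneg _ _)),
      ENNReal.ofReal_mul (posPow_nonneg _ _),
      ENNReal.ofReal_prod_of_nonneg fun i _ => posPow_nonneg _ _]
  have hprod : Integrable fun ξ : Fin m → ℝ => ∏ i, H i (ξ i) := by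
    rw [volume_pi]
    exact Integrable.fintype_prod hH
  -- Integrating in `s` first evaluates the absolute integral by Dirichlet's formula; the resulting
  -- power is at most `1` because its exponent is nonnegative.
  have hint : Integrable (Function.uncurry fun (s ξ : Fin m → ℝ) =>
      (posPow γ (1 - ∑ i, s i) : ℂ) * ∏ i, ((rieszKernel (δ i) (s i) (ξ i) : ℂ) * H i (ξ i)))
      (volume.prod volume) := by
    refine ⟨hmeas.aestronglyMeasurable, ?_⟩
    rw [hasFiniteIntegral_iff_enorm, lintegral_prod_symm _ hmeas.enorm.aemeasurable]
    simp only [Function.uncurry_apply_pair, hinner]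
    calc _ ≤ ∫⁻ ξ : Fin m → ℝ, C * ‖∏ i, H i (ξ i)‖ₑ := by
          refine lintegral_mono fun ξ => ?_
          gcongr
          refine mul_le_of_le_one_right' ?_
          rw [ENNReal.ofReal_le_one]
          rcases le_or_gt (1 - ∑ i, ξ i ^ 2) 0 with h | h
          · rw [posPow_of_nonpos h]
            exact zero_le_one
          · rw [posPow_of_pos h]
            have h0 : 0 ≤ ∑ i, ξ i ^ 2 := Finset.sum_nonneg fun i _ => sq_nonneg (ξ i)
            exact Real.rpow_le_one h.le (by linarith) hα
      _ < ⊤ := by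
          rw [lintegral_const_mul' _ _ ENNReal.coe_ne_top]
          exact ENNReal.mul_lt_top ENNReal.coe_lt_top hprod.2
  calc _ = ∫ ξ : Fin m → ℝ, ∫ s : Fin m → ℝ, (posPow γ (1 - ∑ i, s i) : ℂ) *
        ∏ i, ((rieszKernel (δ i) (s i) (ξ i) : ℂ) * H i (ξ i)) := by
        rw [← integral_const_mul]
        congr 1 with ξ
        have h := integral_prod_posPow (hC (fun i => ξ i ^ 2) 1)
        have e : ∀ s : Fin m → ℝ, (posPow γ (1 - ∑ i, s i) : ℂ) *
            ∏ i, ((rieszKernel (δ i) (s i) (ξ i) : ℂ) * H i (ξ i)) =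
            ((posPow γ (1 - ∑ i, s i) * ∏ i, posPow (δ i) (s i - ξ i ^ 2) : ℝ) : ℂ) *
              ∏ i, H i (ξ i) := fun s => by
          rw [Finset.prod_mul_distrib]
          push_cast [rieszKernel]
          ring
        simp_rw [e]
        rw [integral_mul_const, integral_complex_ofReal, h]
        push_cast
        ring
    _ = ∫ s : Fin m → ℝ, ∫ ξ : Fin m → ℝ, (posPow γ (1 - ∑ i, s i) : ℂ) *
        ∏ i, ((rieszKernel (δ i) (s i) (ξ i) : ℂ) * H i (ξ i)) := (integral_integral_swap hint).symm
    _ = _ := by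
        congr 1 with s
        rw [integral_const_mul, integral_fintype_prod_volume_eq_prod
          (fun i η => (rieszKernel (δ i) (s i) η : ℂ) * H i η)]

lemma fourier_comp_add_div (f : 𝓢(ℝ, ℂ)) (x : ℝ) {R : ℝ} (hR : 0 < R) (η : ℝ) :
    𝓕 (fun y => f (x + y / R)) η =
      R * (𝓕 (f : ℝ → ℂ) (R * η) * Complex.exp (2 * Real.pi * Complex.I * (x * (R * η) : ℝ))) := by
  have hF : ∀ w : ℝ, 𝓕 (f : ℝ → ℂ) w = ∫ z, (Real.fourierChar (-(z * w)) : ℂ) * f z := fun w => by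
    rw [Real.fourier_eq]
    congr 1 with z
    simp only [Circle.smul_def, smul_eq_mul, RCLike.inner_apply, conj_trivial]
    rw [mul_comm w z]
  have hexp : Complex.exp (2 * Real.pi * Complex.I * (x * (R * η) : ℝ)) =
      (Real.fourierChar (x * (R * η)) : ℂ) := by
    rw [Real.fourierChar_apply]
    congr 1
    push_cast
    ring
  rw [Real.fourier_eq, hF, hexp, ← integral_mul_const]
  have hsub : ∫ y : ℝ, (fun z => (Real.fourierChar (-(z * (R * η))) : ℂ) * f z *
      (Real.fourierChar (x * (R * η)) : ℂ)) (x + y / R) =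
      R * ∫ z, (Real.fourierChar (-(z * (R * η))) : ℂ) * f z *
        (Real.fourierChar (x * (R * η)) : ℂ) := by
    rw [Measure.integral_comp_div (fun y => (fun z => (Real.fourierChar (-(z * (R * η))) : ℂ) * f z *
      (Real.fourierChar (x * (R * η)) : ℂ)) (x + y)) R, integral_add_left_eq_self
      (fun z => (Real.fourierChar (-(z * (R * η))) : ℂ) * f z *
      (Real.fourierChar (x * (R * η)) : ℂ)) x, abs_of_pos hR, Complex.real_smul]
  rw [← hsub]
  congr 1 with y
  simp only [Circle.smul_def, smul_eq_mul, RCLike.inner_apply, conj_trivial]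
  rw [mul_right_comm, ← Circle.coe_mul, ← AddChar.map_add_eq_mul]
  congr 3
  field_simp
  ring

/-- Dilating `ξ` by `R` moves both `R` and `x` into the functions, leaving the unit multiplier at
the origin; a bound for that is automatically uniform in `R`. -/
lemma mean_eq_integral {m : ℕ} {α R : ℝ} (hα : 0 < α) (hR : 0 < R) (f : Fin m → 𝓢(ℝ, ℂ)) (x : ℝ) :
    mean α R f x = ∫ ξ : Fin m → ℝ, (posPow α (1 - ∑ i, ξ i ^ 2) : ℂ) *
      ∏ i, 𝓕 (fun y => f i (x + y / R)) (ξ i) := by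
  set Ψ : (Fin m → ℝ) → ℂ := fun ξ => (multiplier α R ξ : ℂ) * (∏ i, 𝓕 (f i : ℝ → ℂ) (ξ i)) *
    Complex.exp (2 * Real.pi * Complex.I * (x * ∑ i, ξ i : ℝ)) with hΨ
  have hmean : mean α R f x = ∫ ξ, Ψ ξ := rfl
  have hscale := Measure.integral_comp_smul (volume : Measure (Fin m → ℝ)) Ψ R
  rw [Module.finrank_fin_fun, abs_of_pos (by positivity)] at hscale
  have : mean α R f x = (R ^ m : ℝ) • ∫ ξ, Ψ (R • ξ) := by
    rw [hscale, smul_smul, mul_inv_cancel₀ (by positivity), one_smul, hmean]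
  rw [this, ← integral_smul]
  congr 1 with ξ
  have hmult : multiplier α R (R • ξ) = posPow α (1 - ∑ i, ξ i ^ 2) := by
    have e : (∑ i, (R • ξ) i ^ 2) / R ^ 2 = ∑ i, ξ i ^ 2 := by
      simp only [Pi.smul_apply, smul_eq_mul, mul_pow, ← Finset.mul_sum]
      field_simp
    rw [multiplier, e]
    rcases le_or_gt (1 - ∑ i, ξ i ^ 2) 0 with h | h
    · rw [max_eq_right h, posPow_of_nonpos h, Real.zero_rpow hα.ne']
    · rw [max_eq_left h.le, posPow_of_pos h]
  have hexp : Complex.exp (2 * Real.pi * Complex.I * (x * ∑ i, (R • ξ) i : ℝ)) =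
      ∏ i, Complex.exp (2 * Real.pi * Complex.I * (x * (R * ξ i) : ℝ)) := by
    rw [← Complex.exp_sum, ← Finset.mul_sum]
    congr 2
    push_cast
    rw [← Finset.mul_sum]
    simp
  simp only [hΨ]
  rw [hmult, hexp]
  simp_rw [fourier_comp_add_div (f _) x hR]
  rw [Finset.prod_mul_distrib, Finset.prod_mul_distrib, Finset.prod_const, Finset.card_univ,
    Fintype.card_fin, Complex.real_smul]
  simp only [Pi.smul_apply, smul_eq_mul]
  push_cast
  ring

lemma integrable_comp_add_div (f : 𝓢(ℝ, ℂ)) (x : ℝ) {R : ℝ} (hR : 0 < R) :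
    Integrable fun y => f (x + y / R) :=
  (f.integrable.comp_add_left x).comp_div hR.ne'

lemma integrable_fourier_comp_add_div (f : 𝓢(ℝ, ℂ)) (x : ℝ) {R : ℝ} (hR : 0 < R) :
    Integrable (𝓕 fun y => f (x + y / R)) := by
  have h : Integrable fun η => 𝓕 (f : ℝ → ℂ) (R * η) := by
    rw [← SchwartzMap.fourier_coe]
    exact (𝓕 f).integrable.comp_mul_left' hR.ne'
  refine (h.const_mul (R : ℂ)).mono
    (continuous_fourier (integrable_comp_add_div f x hR)).aestronglyMeasurable
    (Filter.Eventually.of_forall fun η => le_of_eq ?_)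
  rw [fourier_comp_add_div f x hR, norm_mul, norm_mul, norm_mul,
    show 2 * Real.pi * Complex.I * ((x * (R * η) : ℝ) : ℂ) =
      ((2 * Real.pi * (x * (R * η)) : ℝ) : ℂ) * Complex.I by push_cast; ring,
    Complex.norm_exp_ofReal_mul_I, mul_one]

lemma hlMaximal_enorm_rpow_ne_top (f : 𝓢(ℝ, ℂ)) {s : ℝ} (hs : 0 ≤ s) (x : ℝ) :
    hlMaximal (fun y => ‖f y‖ₑ ^ s) x ≠ ⊤ := by
  obtain ⟨M, hM⟩ : ∃ M : ℝ, ∀ y, ‖f y‖ ≤ M :=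
    ⟨_, fun y => SchwartzMap.norm_le_seminorm ℝ f y⟩
  refine ne_top_of_le_ne_top (b := ENNReal.ofReal M ^ s * 2) (ENNReal.mul_ne_top
    (ENNReal.rpow_ne_top_of_nonneg hs ENNReal.ofReal_ne_top) (by norm_num))
    (iSup₂_le fun r hr => ?_)
  have h0 : ENNReal.ofReal r ≠ 0 := by simpa using hr
  calc (ENNReal.ofReal r)⁻¹ * ∫⁻ y in Metric.closedBall x r, ‖f y‖ₑ ^ s
      ≤ (ENNReal.ofReal r)⁻¹ * ∫⁻ _ in Metric.closedBall x r, ENNReal.ofReal M ^ s := by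
        gcongr with y
        rw [← ofReal_norm]
        exact ENNReal.ofReal_le_ofReal (hM y)
    _ = _ := by
        rw [setLIntegral_const, Real.volume_closedBall, ENNReal.ofReal_mul (by norm_num),
          mul_left_comm, mul_left_comm _ (ENNReal.ofReal 2),
          ENNReal.inv_mul_cancel h0 ENNReal.ofReal_ne_top]
        norm_num

/-- The maximal function is invariant under dilation about `x`, so the bound does not depend on `R`.
-/
lemma lintegral_closedBall_comp_add_div_le (f : 𝓢(ℝ, ℂ)) (s x : ℝ) {R r : ℝ} (hR : 0 < R)
    (hr : 0 < r) : ∫⁻ y in Metric.closedBall 0 r, ‖f (x + y / R)‖ₑ ^ s ≤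
      ENNReal.ofReal r * hlMaximal (fun y => ‖f y‖ₑ ^ s) x := by
  have hm : Measurable ((Metric.closedBall 0 r).indicator fun y => ‖f (x + y / R)‖ₑ ^ s) := by
    have : Measurable f := f.continuous.measurable
    exact Measurable.indicator (by fun_prop) measurableSet_closedBall
  calc ∫⁻ y in Metric.closedBall 0 r, ‖f (x + y / R)‖ₑ ^ s
      = ENNReal.ofReal R * ∫⁻ z in Metric.closedBall x (r / R), ‖f z‖ₑ ^ s := by
        rw [← lintegral_indicator measurableSet_closedBall,
          lintegral_eq_mul_lintegral_comp_mul hR hm, ← lintegral_sub_right_eq_self _ x,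
          ← lintegral_indicator measurableSet_closedBall]
        congr 2 with z
        have h1 : x + R * (z - x) / R = z := by field_simp; ring
        have h2 : R * (z - x) ∈ Metric.closedBall (0 : ℝ) r ↔ z ∈ Metric.closedBall x (r / R) := by
          rw [Metric.mem_closedBall, Metric.mem_closedBall, dist_zero_right, Real.dist_eq,
            Real.norm_eq_abs, abs_mul, abs_of_pos hR, le_div_iff₀ hR, mul_comm]
        by_cases hz : z ∈ Metric.closedBall x (r / R)
        · rw [Set.indicator_of_mem hz, Set.indicator_of_mem (h2.2 hz), h1]
        · rw [Set.indicator_of_notMem hz, Set.indicator_of_notMem (mt h2.1 hz)]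
    _ ≤ ENNReal.ofReal R * (ENNReal.ofReal (r / R) * hlMaximal (fun y => ‖f y‖ₑ ^ s) x) := by
        gcongr
        exact lintegral_closedBall_le_hlMaximal _ _ (by positivity)
    _ = _ := by
        rw [← mul_assoc, ← ENNReal.ofReal_mul hR.le, mul_div_cancel₀ _ hR.ne']

/-- Pointwise domination of the trilinear maximal Bochner–Riesz mean by a product of
Hardy–Littlewood maximal functions. -/
theorem exists_maximalMean_le {α : ℝ} {δ s : Fin 3 → ℝ} (hδ : ∀ i, -(1 / 2) < δ i)
    (hδ0 : ∀ i, δ i ≤ 0) (hs : ∀ i, 1 ≤ s i) (hs2 : ∀ i, s i ≤ 2)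
    (hsδ : ∀ i, 1 / s i < 1 + δ i) (hα : 2 + ∑ i, δ i < α) :
    ∃ K : ℝ≥0, ∀ (f : Fin 3 → 𝓢(ℝ, ℂ)) (x : ℝ), maximalMean α f x ≤
      K * ∏ i, hlMaximal (fun y => ‖f i y‖ₑ ^ s i) x ^ (1 / s i) := by
  -- The exponent left for the simplex weight; `γ > -1` is equivalent to the hypothesis on `α`.
  set γ : ℝ := α - ∑ i, (δ i + 1) with hγ
  have hsum : ∑ i, (δ i + 1) = ∑ i, δ i + 3 := by simp [Finset.sum_add_distrib]
  have hγ1 : -1 < γ := by rw [hγ, hsum]; linarith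
  have hγα : γ + ∑ i, (δ i + 1) = α := by rw [hγ]; ring
  have hδsum : -(3 / 2) < ∑ i, δ i := by
    rw [Fin.sum_univ_three]
    linarith [hδ 0, hδ 1, hδ 2]
  have hα0 : 0 < α := by linarith
  obtain ⟨C, hC0, hC⟩ := exists_lintegral_prod_posPow 3 δ γ (fun i => by linarith [hδ i]) hγ1
  choose D hD using fun i => exists_eLpNorm_rieszKernel_le (hδ i) (hδ0 i) (hs i) (hs2 i) (hsδ i)
  refine ⟨C⁻¹ * (1 / (γ + 1)).toNNReal * ∏ i, D i, fun f x => iSup₂_le fun R hR => ?_⟩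
  set g : Fin 3 → ℝ → ℂ := fun i y => f i (x + y / R) with hg
  have hgi : ∀ i, Integrable (g i) := fun i => integrable_comp_add_div (f i) x hR
  have hid := integral_posPow_mul_prod_eq hC (by rw [hγα]; exact hα0.le)
    (H := fun i => 𝓕 (g i)) (fun i => (continuous_fourier (hgi i)).measurable)
    (fun i => integrable_fourier_comp_add_div (f i) x hR)
  rw [hγα, ← mean_eq_integral hα0 hR f x] at hid
  have hCm : (C : ℝ≥0∞) * ‖mean α R f x‖ₑ = ‖(C : ℂ) * mean α R f x‖ₑ := by
    rw [enorm_mul]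
    congr 1
    rw [← ofReal_norm]
    simp
  have hnorm : ∀ i, (∫⁻ u in Set.Ioo (0 : ℝ) 1,
      ‖fourierKernelOp (rieszKernel (δ i)) (g i) u‖ₑ ^ (3 / 2 : ℝ)) ^ (2 / 3 : ℝ) ≤
      D i * hlMaximal (fun y => ‖f i y‖ₑ ^ s i) x ^ (1 / s i) := by
    intro i
    have h := hD i (g i) (hgi i) _ (hlMaximal_enorm_rpow_ne_top (f i)
      (by linarith [hs i] : 0 ≤ s i) x)
      fun r hr => lintegral_closedBall_comp_add_div_le (f i) (s i) x hR hr
    rw [eLpNorm_eq_lintegral_rpow_enorm_toReal (by simp)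
      (ENNReal.div_ne_top (by norm_num) (by norm_num))] at h
    simpa using h
  have hbound : (C : ℝ≥0∞) * ‖mean α R f x‖ₑ ≤ ENNReal.ofReal (1 / (γ + 1)) *
      ∏ i, (D i * hlMaximal (fun y => ‖f i y‖ₑ ^ s i) x ^ (1 / s i)) := by
    rw [hCm, hid]
    calc _ ≤ ∫⁻ t : Fin 3 → ℝ, ENNReal.ofReal (posPow γ (1 - ∑ i, t i)) *
          ∏ i, ‖fourierKernelOp (rieszKernel (δ i)) (g i) (t i)‖ₑ := by
          refine (enorm_integral_le_lintegral_enorm _).trans (le_of_eq ?_)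
          congr 1 with t
          rw [enorm_mul, enorm_ofReal, Real.enorm_eq_ofReal (posPow_nonneg _ _),
            Fin.prod_univ_three, Fin.prod_univ_three, enorm_mul, enorm_mul]
          rfl
      _ ≤ _ := lintegral_simplex_le hγ1
          (F := fun i u => ‖fourierKernelOp (rieszKernel (δ i)) (g i) u‖ₑ)
          (fun i => (stronglyMeasurable_fourierKernelOp (measurable_rieszKernel _)
            (hgi i)).measurable.enorm) (fun i u hu => by
            rw [enorm_eq_zero, fourierKernelOp]
            refine integral_eq_zero_of_ae (Filter.Eventually.of_forall fun η => ?_)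
            have : u - η ^ 2 ≤ 0 := by linarith [sq_nonneg η]
            simp [rieszKernel, posPow_of_nonpos this])
      _ ≤ _ := by
          gcongr with i
          exact hnorm i
  have hC0' : (C : ℝ≥0∞) ≠ 0 := by exact_mod_cast hC0
  calc ‖mean α R f x‖ₑ = (C : ℝ≥0∞)⁻¹ * (C * ‖mean α R f x‖ₑ) := by
        rw [← mul_assoc, ENNReal.inv_mul_cancel hC0' ENNReal.coe_ne_top, one_mul]
    _ ≤ (C : ℝ≥0∞)⁻¹ * (ENNReal.ofReal (1 / (γ + 1)) *
      ∏ i, (D i * hlMaximal (fun y => ‖f i y‖ₑ ^ s i) x ^ (1 / s i))) := by gcongr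
    _ = _ := by
        rw [Finset.prod_mul_distrib]
        push_cast
        rw [ENNReal.coe_inv hC0, ENNReal.ofReal]
        ring

/-! ### Hölder's inequality and the choice of exponents. -/

lemma lintegral_prod_rpow_le {q : ℝ} {p : Fin 3 → ℝ} (hp : ∀ i, 1 < p i) (hq0 : 0 < q)
    (hq : 1 / q = ∑ i, 1 / p i) {F : Fin 3 → ℝ → ℝ≥0∞} (hF : ∀ i, Measurable (F i)) :
    (∫⁻ x, (∏ i, F i x) ^ q) ^ (1 / q) ≤ ∏ i, (∫⁻ x, F i x ^ p i) ^ (1 / p i) := by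
  have hp0 : ∀ i, 0 < p i := fun i => by linarith [hp i]
  have hsum : ∑ i, q / p i = 1 := by
    simp_rw [div_eq_mul_one_div q, ← Finset.mul_sum, ← hq]
    field_simp
  have h := ENNReal.lintegral_prod_norm_pow_le (μ := (volume : Measure ℝ)) Finset.univ
    (f := fun i x => F i x ^ p i) (fun i _ => ((hF i).pow_const _).aemeasurable) hsum
    (fun i _ => (div_pos hq0 (hp0 i)).le)
  have e : ∀ x, ∏ i, (F i x ^ p i) ^ (q / p i) = (∏ i, F i x) ^ q := by
    intro x
    rw [← ENNReal.prod_rpow_of_nonneg hq0.le]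
    refine Finset.prod_congr rfl fun i _ => ?_
    rw [← ENNReal.rpow_mul, mul_div_cancel₀ _ (hp0 i).ne']
  simp_rw [e] at h
  refine (ENNReal.rpow_le_rpow h (by positivity)).trans (le_of_eq ?_)
  rw [← ENNReal.prod_rpow_of_nonneg (by positivity)]
  refine Finset.prod_congr rfl fun i _ => ?_
  rw [← ENNReal.rpow_mul]
  congr 1
  have := (hp0 i).ne'
  field_simp

theorem exists_eLpNorm_maximalMean_le {p : Fin 3 → ℝ} {q α : ℝ} (hp : ∀ i, 1 < p i)
    (hq : 1 / q = ∑ i, 1 / p i) (hα : 2 + ∑ i, (max (1 / p i) (1 / 2) - 1) < α) :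
    ∃ C : ℝ≥0, ∀ f : Fin 3 → 𝓢(ℝ, ℂ),
      eLpNorm (maximalMean α f) (ENNReal.ofReal q) volume ≤
        C * ∏ i, eLpNorm (f i) (ENNReal.ofReal (p i)) volume := by
  have hp0 : ∀ i, 0 < p i := fun i => by linarith [hp i]
  have hq0 : 0 < q := by
    have : 0 < 1 / q := by
      rw [hq]
      exact Finset.sum_pos (fun i _ => one_div_pos.2 (hp0 i)) Finset.univ_nonempty
    exact one_div_pos.1 this
  set m : Fin 3 → ℝ := fun i => max (1 / p i) (1 / 2) with hm
  have hm1 : ∀ i, m i < 1 := fun i =>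
    max_lt ((div_lt_one (hp0 i)).2 (hp i)) (by norm_num)
  have hm2 : ∀ i, 1 / 2 ≤ m i := fun i => le_max_right _ _
  have hm3 : ∀ i, 1 / p i ≤ m i := fun i => le_max_left _ _
  obtain ⟨ε, hε, hε1, hεα⟩ : ∃ ε : ℝ, 0 < ε ∧ (∀ i, m i + ε ≤ 1) ∧
      2 + ∑ i, (m i - 1 + ε) < α := by
    set d := α - (2 + ∑ i, (m i - 1)) with hd
    have hd0 : 0 < d := sub_pos.2 hα
    -- The three increments use at most `3 * d / 4` of the slack `d`, and `ε ≤ 1 - m i` keeps each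
    -- `δ i = m i - 1 + ε` nonpositive.
    refine ⟨min (d / 4) (min (1 - m 0) (min (1 - m 1) (1 - m 2))), ?_, ?_, ?_⟩
    · simp only [lt_min_iff]
      exact ⟨by positivity, by linarith [hm1 0], by linarith [hm1 1], by linarith [hm1 2]⟩
    · intro i
      set e := min (d / 4) (min (1 - m 0) (min (1 - m 1) (1 - m 2)))
      have h0 : e ≤ 1 - m 0 := (min_le_right _ _).trans (min_le_left _ _)
      have h1 : e ≤ 1 - m 1 :=
        (min_le_right _ _).trans ((min_le_right _ _).trans (min_le_left _ _))
      have h2 : e ≤ 1 - m 2 :=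
        (min_le_right _ _).trans ((min_le_right _ _).trans (min_le_right _ _))
      fin_cases i <;> simp only [Fin.zero_eta, Fin.mk_one, Fin.reduceFinMk] <;> linarith
    · have := min_le_left (d / 4) (min (1 - m 0) (min (1 - m 1) (1 - m 2)))
      rw [Fin.sum_univ_three] at hd ⊢
      linarith
  -- Now `1 / p i ≤ m i < 1 / s i < m i + ε = 1 + δ i`: the first part puts `p i / s i` above `1`
  -- for the maximal theorem, the last makes the dyadic series converge.
  set s : Fin 3 → ℝ := fun i => 1 / (m i + ε / 2) with hs
  have hpos : ∀ i, 0 < m i + ε / 2 := fun i => by linarith [hm2 i]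
  have hs0 : ∀ i, 0 < s i := fun i => one_div_pos.2 (hpos i)
  have hs1 : ∀ i, 1 / s i = m i + ε / 2 := fun i => one_div_one_div _
  obtain ⟨K, hK⟩ := exists_maximalMean_le (α := α) (δ := fun i => m i - 1 + ε) (s := s)
    (fun i => by linarith [hm2 i]) (fun i => by linarith [hε1 i])
    (fun i => (one_le_div (hpos i)).2 (by linarith [hε1 i]))
    (fun i => (div_le_iff₀ (hpos i)).2 (by linarith [hm2 i]))
    (fun i => by rw [hs1]; linarith) hεα
  have hps : ∀ i, 1 < p i / s i := by
    intro i
    rw [div_eq_mul_one_div, hs1]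
    have h1 : p i * (1 / p i) = 1 := mul_one_div_cancel (hp0 i).ne'
    have h2 : p i * (1 / p i) < p i * (m i + ε / 2) :=
      mul_lt_mul_of_pos_left (by linarith [hm3 i]) (hp0 i)
    linarith
  choose D hD using fun i => exists_lintegral_hlMaximal_rpow_le (hps i)
  refine ⟨K * ∏ i, D i ^ (1 / p i), fun f => ?_⟩
  have hfm : ∀ i, Measurable (f i) := fun i => (f i).continuous.measurable
  set F : Fin 3 → ℝ → ℝ≥0∞ :=
    fun i x => hlMaximal (fun y => ‖f i y‖ₑ ^ s i) x ^ (1 / s i) with hF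
  have hFm : ∀ i, Measurable (F i) := fun i => (measurable_hlMaximal _).pow_const _
  have hFp : ∀ i, ∫⁻ x, F i x ^ p i ≤ D i * ∫⁻ x, ‖f i x‖ₑ ^ p i := by
    intro i
    have h := hD i (fun y => ‖f i y‖ₑ ^ s i) ((hfm i).enorm.pow_const _)
    simp only [← ENNReal.rpow_mul, mul_div_cancel₀ _ (hs0 i).ne'] at h
    simp only [hF, ← ENNReal.rpow_mul, one_div_mul_eq_div]
    exact h
  have hLp : ∀ i, eLpNorm (f i) (ENNReal.ofReal (p i)) volume =
      (∫⁻ x, ‖f i x‖ₑ ^ p i) ^ (1 / p i) := by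
    intro i
    rw [eLpNorm_eq_lintegral_rpow_enorm_toReal (by simpa using hp0 i) ENNReal.ofReal_ne_top,
      ENNReal.toReal_ofReal (hp0 i).le]
  calc eLpNorm (maximalMean α f) (ENNReal.ofReal q) volume
      = (∫⁻ x, maximalMean α f x ^ q) ^ (1 / q) := by
        rw [eLpNorm_eq_lintegral_rpow_enorm_toReal (by simpa using hq0) ENNReal.ofReal_ne_top,
          ENNReal.toReal_ofReal hq0.le]
        simp only [enorm_eq_self]
    _ ≤ (∫⁻ x, (K : ℝ≥0∞) ^ q * (∏ i, F i x) ^ q) ^ (1 / q) := by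
        gcongr with x
        rw [← ENNReal.mul_rpow_of_nonneg _ _ hq0.le]
        exact ENNReal.rpow_le_rpow (hK f x) hq0.le
    _ = K * (∫⁻ x, (∏ i, F i x) ^ q) ^ (1 / q) := by
        rw [lintegral_const_mul' _ _ (ENNReal.rpow_ne_top_of_nonneg hq0.le ENNReal.coe_ne_top),
          ENNReal.mul_rpow_of_nonneg _ _ (by positivity), ← ENNReal.rpow_mul,
          mul_one_div_cancel hq0.ne', ENNReal.rpow_one]
    _ ≤ K * ∏ i, (∫⁻ x, F i x ^ p i) ^ (1 / p i) := by
        gcongr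
        exact lintegral_prod_rpow_le hp hq0 hq hFm
    _ ≤ K * ∏ i, (D i * ∫⁻ x, ‖f i x‖ₑ ^ p i) ^ (1 / p i) := by
        gcongr with i
        · exact one_div_nonneg.2 (hp0 i).le
        · exact hFp i
    _ = _ := by
        simp_rw [hLp, ENNReal.mul_rpow_of_nonneg _ _ (one_div_nonneg.2 (hp0 _).le)]
        rw [Finset.prod_mul_distrib, ENNReal.coe_mul, mul_assoc, ENNReal.ofNNReal_finsetProd]
        congr 3 with i
        rw [ENNReal.coe_rpow_of_nonneg _ (one_div_nonneg.2 (hp0 i).le)]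

end BochnerRiesz

theorem mainTheorem2 (p : Fin 3 → ℝ) (q α : ℝ) (hp : ∀ i, 1 < p i)
    (hq : 1 / q = ∑ i, 1 / p i)
    (hα :
      ((∀ i, 2 ≤ p i) ∧ 1 / 2 < α) ∨
      (∃ i j k : Fin 3, i ≠ j ∧ j ≠ k ∧ i ≠ k ∧
        p i < 2 ∧ 2 ≤ p j ∧ 2 ≤ p k ∧ 1 / p i < α) ∨
      (∃ i j k : Fin 3, i ≠ j ∧ j ≠ k ∧ i ≠ k ∧
        p i < 2 ∧ p j < 2 ∧ 2 ≤ p k ∧ 1 / p i + 1 / p j - 1 / 2 < α) ∨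
      ((∀ i, p i < 2) ∧ 1 / q - 1 < α)) :
    ∃ C : ℝ≥0, ∀ f : Fin 3 → 𝓢(ℝ, ℂ),
      eLpNorm (BochnerRiesz.maximalMean α f) (ENNReal.ofReal q) volume ≤
        C * ∏ i, eLpNorm (f i) (ENNReal.ofReal (p i)) volume := by
  -- The four cases are the single condition `α > ∑ max (1 / p i) (1 / 2) - 1`, sorted by how many
  -- `p i` lie below `2`.
  refine BochnerRiesz.exists_eLpNorm_maximalMean_le hp hq ?_
  have hbig : ∀ i, 2 ≤ p i → max (1 / p i) (1 / 2) = 1 / 2 := fun i hi =>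
    max_eq_right (one_div_le_one_div_of_le (by norm_num) hi)
  have hsmall : ∀ i, p i < 2 → max (1 / p i) (1 / 2) = 1 / p i := fun i hi =>
    max_eq_left (one_div_le_one_div_of_le (by linarith [hp i]) hi.le)
  have hperm : ∀ i j k : Fin 3, i ≠ j → j ≠ k → i ≠ k → ∀ F : Fin 3 → ℝ,
      ∑ l, F l = F i + F j + F k := by
    intro i j k hij hjk hik F
    have huniv : (Finset.univ : Finset (Fin 3)) = {i, j, k} := by
      revert i j k
      decide
    rw [huniv, Finset.sum_insert (by simp [hij, hik]), Finset.sum_pair hjk, add_assoc]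
  rcases hα with ⟨h, hα⟩ | ⟨i, j, k, hij, hjk, hik, hi, hj, hk, hα⟩ |
    ⟨i, j, k, hij, hjk, hik, hi, hj, hk, hα⟩ | ⟨h, hα⟩
  · rw [Fin.sum_univ_three, hbig _ (h 0), hbig _ (h 1), hbig _ (h 2)]
    linarith
  · rw [hperm i j k hij hjk hik, hsmall i hi, hbig j hj, hbig k hk]
    linarith
  · rw [hperm i j k hij hjk hik, hsmall i hi, hsmall j hj, hbig k hk]
    linarith
  · rw [hq, Fin.sum_univ_three] at hα
    rw [Fin.sum_univ_three, hsmall _ (h 0), hsmall _ (h 1), hsmall _ (h 2)]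
    linarith
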